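/- Let $X$ be a smooth affine irreducible curve over $\mathbb{C}$, let $\mathcal{O}=\mathcal{O}(X)$ be its ring of regular functions, and let $\mathcal{I}$ be a line bundle on $X$, i.e. an invertible $\mathcal{O}$-module. Let $B=\mathcal{O}[\mathcal{I}]=\begin{pmatrix}\mathcal{O}&\mathcal{I}\\0&\mathbb{C}\end{pmatrix}$ be the one-point extension, with idempotents $e=\begin{pmatrix}1&0\\0&0\end{pmatrix}$ and $e_\infty=\begin{pmatrix}0&0\\0&1\end{pmatrix}$. Let $\mathrm{Der}(B,B^{\otimes 2})$ be the space of $\mathbb{C}$-linear derivations $B\to B\otimes_{\mathbb{C}}B$ with respect to the outer bimodule structure $a.(x\otimes y).b=ax\otimes yb$, regarded as a $B$-bimodule through the inner structure $a.(x\otimes y).b=xb\otimes ay$, and let $\Delta_B\in\mathrm{Der}(B,B^{\otimes 2})$ be the derivation $x\mapsto x\otimes 1-1\otimes x$. For $\boldsymbol{\lambda}=(\lambda,\lambda_\infty)=\lambda e+\lambda_\infty e_\infty\in B$ let $$\Pi^{\boldsymbol{\lambda}}(B)=T_B\,\mathrm{Der}(B,B^{\otimes 2})/\langle\Delta_B-\boldsymbol{\lambda}\rangle$$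 be the deformed preprojective algebra, where $T_B$ denotes the tensor algebra of a $B$-bimodule. A $\Pi^{\boldsymbol{\lambda}}(B)$-module $\boldsymbol{V}$ has dimension vector $(n,n_\infty)$ if it is finite-dimensional over $\mathbb{C}$ with $\dim_{\mathbb{C}} e\boldsymbol{V}=n$ and $\dim_{\mathbb{C}} e_\infty\boldsymbol{V}=n_\infty$. Let $n\ge 0$ be an integer and $\boldsymbol{\lambda}=(1,-n)$. Then $\Pi^{\boldsymbol{\lambda}}(B)$ has a module of dimension vector $(n,1)$, and every $\Pi^{\boldsymbol{\lambda}}(B)$-module of dimension vector $(n,1)$ is simple. -/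

import Mathlib

open scoped TensorProduct

/-- The one-point extension `A[I]` of a `k`-algebra `A` by a left `A`-module `I`: the algebra of
upper triangular matrices with rows `(corner, vec)` and `(0, scal)`, where
`corner ∈ A`, `vec ∈ I` and `scal ∈ k`. -/
@[ext]
structure OnePointExt (k A I : Type*) where
  corner : A
  vec : I
  scal : k

namespace OnePointExt

set_option linter.unusedSectionVars false

variable {k A I : Type*} [CommRing k] [Ring A] [Algebra k A]
  [AddCommGroup I] [Module k I] [Module A I] [IsScalarTower k A I]

instance : Zero (OnePointExt k A I) := ⟨⟨0, 0, 0⟩⟩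
instance : One (OnePointExt k A I) := ⟨⟨1, 0, 1⟩⟩
instance : Add (OnePointExt k A I) :=
  ⟨fun x y => ⟨x.corner + y.corner, x.vec + y.vec, x.scal + y.scal⟩⟩
instance : Neg (OnePointExt k A I) := ⟨fun x => ⟨-x.corner, -x.vec, -x.scal⟩⟩

/-- Multiplication of upper triangular matrices (scalars act on `I` from the right as they do from
the left). -/
instance : Mul (OnePointExt k A I) :=
  ⟨fun x y => ⟨x.corner * y.corner, x.corner • y.vec + y.scal • x.vec, x.scal * y.scal⟩⟩

@[simp] theorem corner_zero : (0 : OnePointExt k A I).corner = 0 := rfl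
@[simp] theorem vec_zero : (0 : OnePointExt k A I).vec = 0 := rfl
@[simp] theorem scal_zero : (0 : OnePointExt k A I).scal = 0 := rfl
@[simp] theorem corner_one : (1 : OnePointExt k A I).corner = 1 := rfl
@[simp] theorem vec_one : (1 : OnePointExt k A I).vec = 0 := rfl
@[simp] theorem scal_one : (1 : OnePointExt k A I).scal = 1 := rfl
@[simp] theorem corner_add (x y : OnePointExt k A I) :
    (x + y).corner = x.corner + y.corner := rfl
@[simp] theorem vec_add (x y : OnePointExt k A I) : (x + y).vec = x.vec + y.vec := rfl
@[simp] theorem scal_add (x y : OnePointExt k A I) : (x + y).scal = x.scal + y.scal := rfl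
@[simp] theorem corner_neg (x : OnePointExt k A I) : (-x).corner = -x.corner := rfl
@[simp] theorem vec_neg (x : OnePointExt k A I) : (-x).vec = -x.vec := rfl
@[simp] theorem scal_neg (x : OnePointExt k A I) : (-x).scal = -x.scal := rfl
@[simp] theorem corner_mul (x y : OnePointExt k A I) :
    (x * y).corner = x.corner * y.corner := rfl
@[simp] theorem vec_mul (x y : OnePointExt k A I) :
    (x * y).vec = x.corner • y.vec + y.scal • x.vec := rfl
@[simp] theorem scal_mul (x y : OnePointExt k A I) : (x * y).scal = x.scal * y.scal := rfl

instance : Ring (OnePointExt k A I) where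
  add_assoc x y z := by ext <;> simp [add_assoc]
  zero_add x := by ext <;> simp
  add_zero x := by ext <;> simp
  add_comm x y := by ext <;> simp [add_comm]
  neg_add_cancel x := by ext <;> simp
  left_distrib x y z := by
    ext <;> simp only [corner_add, vec_add, scal_add, corner_mul, vec_mul, scal_mul, mul_add,
      smul_add, add_smul]
    abel
  right_distrib x y z := by
    ext <;> simp only [corner_add, vec_add, scal_add, corner_mul, vec_mul, scal_mul, add_mul,
      smul_add, add_smul]
    abel
  zero_mul x := by ext <;> simp
  mul_zero x := by ext <;> simp
  mul_assoc x y z := by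
    ext
    · simp [mul_assoc]
    · have h : x.corner • z.scal • y.vec = z.scal • x.corner • y.vec := by
        rw [← algebraMap_smul A z.scal y.vec, ← algebraMap_smul A z.scal (x.corner • y.vec),
          smul_smul, smul_smul, Algebra.commutes]
      simp only [vec_mul, corner_mul, scal_mul, smul_add, mul_smul, h,
        smul_comm y.scal z.scal x.vec, add_assoc]
    · simp [mul_assoc]
  one_mul x := by ext <;> simp
  mul_one x := by ext <;> simp
  nsmul := nsmulRec
  zsmul := zsmulRec

/-- `A[I]` is a `k`-algebra through the scalar matrices. -/
instance : Algebra k (OnePointExt k A I) :=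
  RingHom.toAlgebra'
    { toFun := fun r => ⟨algebraMap k A r, 0, r⟩
      map_one' := by ext <;> simp
      map_mul' := fun r s => by ext <;> simp
      map_zero' := by ext <;> simp
      map_add' := fun r s => by ext <;> simp }
    (fun r x => by
      ext
      · exact Algebra.commutes r x.corner
      · change algebraMap k A r • x.vec + x.scal • (0 : I) = x.corner • (0 : I) + r • x.vec
        simp
      · exact mul_comm r x.scal)

variable (k A I)

/-- The idempotent matrix `e` with upper left entry `1` and all other entries `0`. -/
def e : OnePointExt k A I := ⟨1, 0, 0⟩

/-- The idempotent matrix `e_∞` with lower right entry `1` and all other entries `0`. -/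
def eInf : OnePointExt k A I := ⟨0, 0, 1⟩

end OnePointExt

section DoubleDerivations

variable (k A : Type*) [CommRing k] [Ring A] [Algebra k A]

/-- `Der(A, A ⊗ A)`: the `k`-linear maps `d : A → A ⊗ A` which are derivations for the outer
bimodule structure `a.(x ⊗ y).b = ax ⊗ yb`, that is, `d(ab) = a.d(b) + d(a).b`.
The outer actions are written with the product of the algebra `A ⊗ A`:
`a.t = (a ⊗ 1) * t` and `t.b = t * (1 ⊗ b)`. -/
@[ext]
structure DoubleDer where
  toLin : A →ₗ[k] A ⊗[k] A
  leibniz : ∀ a b : A,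
    toLin (a * b) = (a ⊗ₜ[k] (1 : A)) * toLin b + toLin a * ((1 : A) ⊗ₜ[k] b)

namespace DoubleDer

variable {k A}

instance : Zero (DoubleDer k A) := ⟨⟨0, fun a b => by simp⟩⟩

instance : Add (DoubleDer k A) :=
  ⟨fun d d' => ⟨d.toLin + d'.toLin, fun a b => by
    simp only [LinearMap.add_apply, d.leibniz, d'.leibniz, mul_add, add_mul]; abel⟩⟩

instance : Neg (DoubleDer k A) :=
  ⟨fun d => ⟨-d.toLin, fun a b => by
    simp only [LinearMap.neg_apply, d.leibniz, mul_neg, neg_mul]; abel⟩⟩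

@[simp] theorem toLin_zero : (0 : DoubleDer k A).toLin = 0 := rfl
@[simp] theorem toLin_add (d d' : DoubleDer k A) : (d + d').toLin = d.toLin + d'.toLin := rfl
@[simp] theorem toLin_neg (d : DoubleDer k A) : (-d).toLin = -d.toLin := rfl

instance : AddCommGroup (DoubleDer k A) where
  add_assoc d d' d'' := by ext1; simp [add_assoc]
  zero_add d := by ext1; simp
  add_zero d := by ext1; simp
  add_comm d d' := by ext1; simp [add_comm]
  neg_add_cancel d := by ext1; simp
  nsmul := nsmulRec
  zsmul := zsmulRec

/-- The left action of `A` on `Der(A, A ⊗ A)` induced by the inner bimodule structure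
`a.(x ⊗ y).b = xb ⊗ ay`: here `(a.d)(x) = (1 ⊗ a) * d(x)`. -/
instance : SMul A (DoubleDer k A) :=
  ⟨fun a d => ⟨LinearMap.mulLeft k ((1 : A) ⊗ₜ[k] a) ∘ₗ d.toLin, fun x y => by
    simp only [LinearMap.comp_apply, LinearMap.mulLeft_apply, d.leibniz, mul_add, ← mul_assoc,
      Algebra.TensorProduct.tmul_mul_tmul, one_mul, mul_one]⟩⟩

/-- The right action of `A` on `Der(A, A ⊗ A)` induced by the inner bimodule structure
`a.(x ⊗ y).b = xb ⊗ ay`: here `(d.b)(x) = d(x) * (b ⊗ 1)`. -/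
instance : SMul Aᵐᵒᵖ (DoubleDer k A) :=
  ⟨fun b d => ⟨LinearMap.mulRight k (b.unop ⊗ₜ[k] (1 : A)) ∘ₗ d.toLin, fun x y => by
    simp only [LinearMap.comp_apply, LinearMap.mulRight_apply, d.leibniz, add_mul, mul_assoc,
      Algebra.TensorProduct.tmul_mul_tmul, one_mul, mul_one]⟩⟩

theorem toLin_smul (a : A) (d : DoubleDer k A) (x : A) :
    (a • d).toLin x = ((1 : A) ⊗ₜ[k] a) * d.toLin x := rfl

theorem toLin_op_smul (b : Aᵐᵒᵖ) (d : DoubleDer k A) (x : A) :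
    (b • d).toLin x = d.toLin x * (b.unop ⊗ₜ[k] (1 : A)) := rfl

instance : Module A (DoubleDer k A) where
  one_smul d := by
    ext1; ext x; rw [toLin_smul, ← Algebra.TensorProduct.one_def, one_mul]
  mul_smul a b d := by
    ext1; ext x
    rw [toLin_smul, toLin_smul, toLin_smul, ← mul_assoc, Algebra.TensorProduct.tmul_mul_tmul,
      one_mul]
  smul_zero a := by ext1; ext x; simp [toLin_smul]
  smul_add a d d' := by ext1; ext x; simp [toLin_smul, mul_add]
  add_smul a b d := by ext1; ext x; simp [toLin_smul, TensorProduct.tmul_add, add_mul]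
  zero_smul d := by ext1; ext x; simp [toLin_smul]

instance : Module Aᵐᵒᵖ (DoubleDer k A) where
  one_smul d := by
    ext1; ext x
    rw [toLin_op_smul, MulOpposite.unop_one, ← Algebra.TensorProduct.one_def, mul_one]
  mul_smul a b d := by
    ext1; ext x
    rw [toLin_op_smul, toLin_op_smul, toLin_op_smul, mul_assoc,
      Algebra.TensorProduct.tmul_mul_tmul, one_mul, MulOpposite.unop_mul]
  smul_zero a := by ext1; ext x; simp [toLin_op_smul]
  smul_add a d d' := by ext1; ext x; simp [toLin_op_smul, add_mul]
  add_smul a b d := by ext1; ext x; simp [toLin_op_smul, TensorProduct.add_tmul, mul_add]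
  zero_smul d := by ext1; ext x; simp [toLin_op_smul]

instance : SMulCommClass A Aᵐᵒᵖ (DoubleDer k A) :=
  ⟨fun a b d => by ext1; ext x; simp [toLin_smul, toLin_op_smul, mul_assoc]⟩

variable (k A)

/-- The distinguished derivation `Δ : x ↦ x ⊗ 1 - 1 ⊗ x`. -/
def Delta : DoubleDer k A where
  toLin := (TensorProduct.mk k A A).flip 1 - TensorProduct.mk k A A 1
  leibniz a b := by simp [mul_sub, sub_mul]

end DoubleDer

end DoubleDerivations

section BimoduleTensorAlgebra

variable (k A M : Type*) [CommRing k] [Ring A] [Algebra k A]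
  [AddCommGroup M] [Module A M] [Module Aᵐᵒᵖ M]

/-- The relations which turn the free `k`-algebra on `A ⊔ M` into the tensor algebra `T_A(M)` of
the `A`-bimodule `M`: `A` embeds as a `k`-algebra, `M` embeds additively, and the products
`a * m` and `m * b` are those of the bimodule. -/
inductive BimodTensorAlgebra.Rel : FreeAlgebra k (A ⊕ M) → FreeAlgebra k (A ⊕ M) → Prop
  | base_add (a b : A) : Rel (FreeAlgebra.ι k (Sum.inl (a + b)))
      (FreeAlgebra.ι k (Sum.inl a) + FreeAlgebra.ι k (Sum.inl b))
  | base_mul (a b : A) : Rel (FreeAlgebra.ι k (Sum.inl (a * b)))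
      (FreeAlgebra.ι k (Sum.inl a) * FreeAlgebra.ι k (Sum.inl b))
  | base_algebraMap (r : k) : Rel (FreeAlgebra.ι k (Sum.inl (algebraMap k A r)))
      (algebraMap k (FreeAlgebra k (A ⊕ M)) r)
  | mod_add (m m' : M) : Rel (FreeAlgebra.ι k (Sum.inr (m + m')))
      (FreeAlgebra.ι k (Sum.inr m) + FreeAlgebra.ι k (Sum.inr m'))
  | left_smul (a : A) (m : M) : Rel (FreeAlgebra.ι k (Sum.inr (a • m)))
      (FreeAlgebra.ι k (Sum.inl a) * FreeAlgebra.ι k (Sum.inr m))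
  | right_smul (m : M) (b : A) : Rel (FreeAlgebra.ι k (Sum.inr (MulOpposite.op b • m)))
      (FreeAlgebra.ι k (Sum.inr m) * FreeAlgebra.ι k (Sum.inl b))

/-- The tensor algebra `T_A(M) = A ⊕ M ⊕ (M ⊗_A M) ⊕ ⋯` of an `A`-bimodule `M`, presented by
generators and relations: it is the universal `k`-algebra with a `k`-algebra map from `A` and an
`A`-bimodule map from `M`. -/
abbrev BimodTensorAlgebra := RingQuot (BimodTensorAlgebra.Rel k A M)

namespace BimodTensorAlgebra

/-- The canonical algebra map `A → T_A(M)`. -/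
def ofBase : A →ₐ[k] BimodTensorAlgebra k A M :=
  AlgHom.ofLinearMap
    { toFun := fun a => RingQuot.mkAlgHom k (Rel k A M) (FreeAlgebra.ι k (Sum.inl a))
      map_add' := fun a b => by
        rw [← map_add]; exact RingQuot.mkAlgHom_rel k (Rel.base_add a b)
      map_smul' := fun r a => by
        rw [Algebra.smul_def, RingQuot.mkAlgHom_rel k (Rel.base_mul (algebraMap k A r) a),
          map_mul, RingQuot.mkAlgHom_rel k (Rel.base_algebraMap r), AlgHom.commutes,
          RingHom.id_apply, Algebra.smul_def] }
    (by
      have h := RingQuot.mkAlgHom_rel k (Rel.base_algebraMap (A := A) (M := M) (1 : k))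
      rw [map_one, map_one, map_one] at h
      exact h)
    (fun a b => (RingQuot.mkAlgHom_rel k (Rel.base_mul a b)).trans (map_mul _ _ _))

/-- The canonical map `M → T_A(M)`. -/
def ofBimod : M →+ BimodTensorAlgebra k A M :=
  AddMonoidHom.mk' (fun m => RingQuot.mkAlgHom k (Rel k A M) (FreeAlgebra.ι k (Sum.inr m)))
    (fun m m' => (RingQuot.mkAlgHom_rel k (Rel.mod_add m m')).trans (map_add _ _ _))

end BimodTensorAlgebra

end BimoduleTensorAlgebra

section DeformedPreprojective

variable (k : Type*) {A : Type*} [CommRing k] [Ring A] [Algebra k A] (lam : A)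

/-- The relation `Δ = λ` in `T_A Der(A, A ⊗ A)`. -/
inductive DefPreproj.Rel :
    BimodTensorAlgebra k A (DoubleDer k A) → BimodTensorAlgebra k A (DoubleDer k A) → Prop
  | delta : Rel (BimodTensorAlgebra.ofBimod k A (DoubleDer k A) (DoubleDer.Delta k A))
      (BimodTensorAlgebra.ofBase k A (DoubleDer k A) lam)

/-- The deformed preprojective algebra `Π^λ(A) = T_A Der(A, A ⊗ A) / ⟨Δ - λ⟩`. -/
abbrev DefPreproj := RingQuot (DefPreproj.Rel k lam)

/-- The canonical algebra map `A → Π^λ(A)`. -/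
def DefPreproj.ofBase : A →ₐ[k] DefPreproj k lam :=
  (RingQuot.mkAlgHom k (DefPreproj.Rel k lam)).comp
    (BimodTensorAlgebra.ofBase k A (DoubleDer k A))

end DeformedPreprojective

/-- The weight `λ e + λ_∞ e_∞`, as an element of the one-point extension `A[I]`. -/
def OnePointExt.weight {k : Type*} (A I : Type*) [CommRing k] [Ring A] [Algebra k A]
    [AddCommGroup I] [Module k I] [Module A I] [IsScalarTower k A I] (l lInf : k) :
    OnePointExt k A I :=
  l • OnePointExt.e k A I + lInf • OnePointExt.eInf k A I

/-- A module `V` over `Π^λ(A[I])` has dimension vector `(n, m)` if it is finite-dimensional and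
the images `e V` and `e_∞ V` of the idempotents `e` and `e_∞` have dimensions `n` and `m`. -/
def HasDimVector {k A I : Type*} [Field k] [Ring A] [Algebra k A]
    [AddCommGroup I] [Module k I] [Module A I] [IsScalarTower k A I] {lam : OnePointExt k A I}
    (V : Type*) [AddCommGroup V] [Module k V] [Module (DefPreproj k lam) V]
    [IsScalarTower k (DefPreproj k lam) V] (n m : ℕ) : Prop :=
  Module.Finite k V ∧
  Module.finrank k (LinearMap.range (Algebra.lsmul k k V
    (DefPreproj.ofBase k lam (OnePointExt.e k A I)))) = n ∧
  Module.finrank k (LinearMap.range (Algebra.lsmul k k V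
    (DefPreproj.ofBase k lam (OnePointExt.eInf k A I)))) = m

/-! ### Points of affine domains and products of varieties -/

open scoped TensorProduct

/-! Simplicity is a trace argument. If `Δ` lies in the commutator subgroup `[B, Der(B, B ⊗ B)]`,
then the image of `Δ`, which is `λ`, has trace zero on every finite-dimensional `Π^λ(B)`-module, so
`dim eW = n · dim e_∞W`. A submodule of a module of dimension vector `(n, 1)` then has dimension
vector `(0, 0)` or `(n, 1)`.

That `Δ` is a sum of commutators (`OnePointExt.Delta_mem_commutators`) is geometric. Let `J` be the
ideal of the diagonal in `O ⊗ O`. Double derivations of `O` are the `O ⊗ O`-linear maps `J → O ⊗ O`,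
and `Δ_O` is the inclusion of `J`. Modulo commutators `O ⊗ O` acts through multiplication to `O`, so
`J · Hom(J, O ⊗ O)` dies. The inclusion lies there because the diagonal of a smooth curve is a
Cartier divisor: `Ω` has rank at most one, and Nakayama lifts a local generator of `J/J²` to one of
`J`. A Grassmann connection on `I` carries this from `O` to `O[I]`.

Existence takes `n` distinct points and the fibres of `I` there, which give a representation of `B`
with only scalar endomorphisms. A representation lifts to `Π^λ(B)` as soon as `λ` is
trace-orthogonal to its endomorphisms (`DefPreproj.exists_algHom_of_trace_eq_zero`), and on scalars
the trace is a multiple of `n - n = 0`. -/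

theorem exists_algHom_apply_ne_zero {k A : Type*} [Field k] [IsAlgClosed k] [CommRing A]
    [IsDomain A] [Algebra k A] [Algebra.FiniteType k A] {a : A} (ha : a ≠ 0) :
    ∃ χ : A →ₐ[k] k, χ a ≠ 0 := by
  -- By the Nullstellensatz some maximal ideal avoids `a`, and its residue field is `k`.
  have hJ : IsJacobsonRing A := isJacobsonRing_of_finiteType (A := k)
  have h0 : (⊥ : Ideal A).jacobson = ⊥ := hJ.out Ideal.isPrime_bot.isRadical
  have : a ∉ (⊥ : Ideal A).jacobson := by rw [h0]; simpa using ha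
  rw [Ideal.jacobson, Ideal.mem_sInf] at this
  push Not at this
  obtain ⟨m, ⟨-, hm⟩, ham⟩ := this
  let := Ideal.Quotient.field m
  have hfin : Module.Finite k (A ⧸ m) := finite_of_finite_type_of_isJacobsonRing k (A ⧸ m)
  have hb := IsAlgClosed.algebraMap_bijective_of_isIntegral (k := k) (K := A ⧸ m)
  let ε : k ≃ₐ[k] A ⧸ m := AlgEquiv.ofBijective (Algebra.ofId k (A ⧸ m)) hb
  refine ⟨(ε.symm : (A ⧸ m) →ₐ[k] k).comp (Ideal.Quotient.mkₐ k m), fun h => ham ?_⟩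
  have h' : ε.symm (Ideal.Quotient.mk m a) = 0 := h
  rw [EmbeddingLike.map_eq_zero_iff] at h'
  exact Ideal.Quotient.eq_zero_iff_mem.mp h'

/-- The tensor product of two domains over an algebraically closed field, one of them of finite
type, is a domain. -/
theorem isDomain_tensorProduct_of_isAlgClosed (k A B : Type*) [Field k] [IsAlgClosed k]
    [CommRing A] [IsDomain A] [Algebra k A] [Algebra.FiniteType k A]
    [CommRing B] [IsDomain B] [Algebra k B] : IsDomain (A ⊗[k] B) := by
  let b := Module.Free.chooseBasis k B
  let bA := Algebra.TensorProduct.basis A b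
  -- Specialisation at a point `χ` of `A` applies `χ` to the coordinates over a `k`-basis of `B`. A
  -- point where one coordinate of each factor survives reduces the claim to the domain `B`.
  let Φ (χ : A →ₐ[k] k) : A ⊗[k] B →ₐ[k] B :=
    Algebra.TensorProduct.lift ((Algebra.ofId k B).comp χ) (AlgHom.id k B)
      (fun _ _ => Commute.all _ _)
  have hΦ (χ : A →ₐ[k] k) (f : A ⊗[k] B) (i) : b.repr (Φ χ f) i = χ (bA.repr f i) := by
    induction f with
    | zero => simp
    | add x y hx hy => simp [hx, hy]
    | tmul x y =>
      have : Φ χ (x ⊗ₜ y) = χ x • y := by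
        simp [Φ, Algebra.ofId_apply, Algebra.smul_def]
      rw [this]
      simp [bA, Algebra.TensorProduct.basis_repr_tmul]
  have : Nontrivial (A ⊗[k] B) := inferInstance
  have : NoZeroDivisors (A ⊗[k] B) := by
    refine ⟨fun {f g} hfg => ?_⟩
    by_contra! h
    obtain ⟨hf, hg⟩ := h
    have hne {f : A ⊗[k] B} (hf : f ≠ 0) : ∃ i, bA.repr f i ≠ 0 := by
      by_contra! h
      exact hf ((bA.repr.map_eq_zero_iff).mp (Finsupp.ext h))
    obtain ⟨i, hi⟩ := hne hf
    obtain ⟨j, hj⟩ := hne hg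
    obtain ⟨χ, hχ⟩ := exists_algHom_apply_ne_zero (k := k) (mul_ne_zero hi hj)
    rw [map_mul] at hχ
    have h0 : Φ χ f * Φ χ g = 0 := by rw [← map_mul, hfg, map_zero]
    rcases mul_eq_zero.mp h0 with h | h
    · exact left_ne_zero_of_mul hχ (by rw [← hΦ, h]; simp)
    · exact right_ne_zero_of_mul hχ (by rw [← hΦ, h]; simp)
  exact NoZeroDivisors.to_isDomain _

/-! ### Rank of the Kähler differentials -/

open Polynomial in
-- If `P` is the minimal polynomial of `y`, then `P'(y) dy = d(P(y)) = 0`, and `P'(y) ≠ 0` since in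
-- characteristic zero `P'` is nonzero of smaller degree. So all differentials are torsion.
theorem rank_kaehlerDifferential_eq_zero_of_isIntegral (A O : Type*) [CommRing A] [IsDomain A]
    [CharZero A] [IsIntegrallyClosed A] [CommRing O] [IsDomain O] [Algebra A O] [Module.IsTorsionFree A O]
    [Algebra.IsIntegral A O] : Module.rank O (Ω[O⁄A]) = 0 := by
  rw [rank_eq_zero_iff]
  intro ω
  have hω : ω ∈ Submodule.span O (Set.range (KaehlerDifferential.D A O)) := by
    rw [KaehlerDifferential.span_range_derivation]; trivial
  induction hω using Submodule.span_induction with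
  | mem x h =>
    obtain ⟨y, rfl⟩ := h
    have hy := Algebra.IsIntegral.isIntegral (R := A) y
    refine ⟨aeval y (derivative (minpoly A y)), fun h => ?_, ?_⟩
    · have hdvd := minpoly.isIntegrallyClosed_dvd hy h
      have hpos := minpoly.natDegree_pos hy
      have hne : derivative (minpoly A y) ≠ 0 := fun h0 =>
        hpos.ne' (derivative_eq_zero.mp h0)
      have h1 := degree_le_of_dvd hdvd hne
      exact absurd h1 (not_le.mpr (degree_derivative_lt (minpoly.ne_zero hy)))
    · have := Derivation.map_aeval (KaehlerDifferential.D A O) (minpoly A y) y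
      rw [← this, minpoly.aeval, map_zero]
  | zero => exact ⟨1, one_ne_zero, smul_zero _⟩
  | add x y _ _ hx hy =>
    obtain ⟨a, ha, hx⟩ := hx
    obtain ⟨b, hb, hy⟩ := hy
    refine ⟨b * a, mul_ne_zero hb ha, ?_⟩
    rw [smul_add, mul_smul, hx, mul_comm, mul_smul, hy, smul_zero, smul_zero, add_zero]
  | smul c x _ hx =>
    obtain ⟨a, ha, hx⟩ := hx
    exact ⟨a, ha, by rw [smul_comm, hx, smul_zero]⟩
    

/-- In the exact sequence `O ⊗ Ω[A⁄k] → Ω[O⁄k] → Ω[O⁄A]` the last term has rank zero, so the rank in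
the middle comes from the first. -/
theorem finrank_kaehlerDifferential_le_of_isIntegral (k A O : Type*) [CommRing k] [CommRing A]
    [IsDomain A] [CharZero A] [IsIntegrallyClosed A] [CommRing O] [IsDomain O] [Algebra A O]
    [Module.IsTorsionFree A O] [Algebra.IsIntegral A O] [Algebra k A] [Algebra k O]
    [IsScalarTower k A O] [Module.Free A (Ω[A⁄k])] [Module.Finite A (Ω[A⁄k])]
    [Module.Finite O (Ω[O⁄k])] :
    Module.finrank O (Ω[O⁄k]) ≤ Module.finrank A (Ω[A⁄k]) := by
  let f := KaehlerDifferential.map k A O O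
  have hker : LinearMap.ker f = LinearMap.range (KaehlerDifferential.mapBaseChange k A O) :=
    (KaehlerDifferential.range_mapBaseChange k A O).symm
  have h1 := rank_quotient_add_rank_of_isDomain (LinearMap.ker f)
  have h2 : Module.rank O (Ω[O⁄k] ⧸ LinearMap.ker f) = 0 := by
    rw [f.quotKerEquivRange.rank_eq]
    exact le_antisymm ((Submodule.rank_le _).trans
      (rank_kaehlerDifferential_eq_zero_of_isIntegral A O).le) zero_le
  rw [h2, zero_add] at h1
  rw [Module.finrank, ← h1, hker]
  refine (LinearMap.finrank_range_le _).trans ?_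
  rw [Module.finrank_baseChange]

/-- Lying over lifts the bottom of a chain of primes, and going up lifts the rest. -/
theorem ringKrullDim_le_of_isIntegral (A O : Type*) [CommRing A] [IsDomain A] [CommRing O]
    [IsDomain O] [Algebra A O] [Algebra.IsIntegral A O] (h : Function.Injective (algebraMap A O)) :
    ringKrullDim A ≤ ringKrullDim O := by
  refine iSup_le fun l => ?_
  obtain ⟨P, hP, hPl⟩ := Ideal.exists_ideal_over_prime_of_isIntegral_of_isDomain (S := O)
    l.head.asIdeal (by rw [(RingHom.injective_iff_ker_eq_bot _).mp h]; exact bot_le)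
  have : P.LiesOver (RelSeries.head l).asIdeal := ⟨hPl.symm⟩
  obtain ⟨L, hL, -⟩ := Ideal.exists_ltSeries_of_hasGoingUp l P
  rw [← hL]
  exact le_iSup (fun p : LTSeries (PrimeSpectrum O) => (p.length : WithBot ℕ∞)) L

/-- The rank of the Kähler differentials of an affine domain over a field of characteristic zero
is at most its Krull dimension. -/
theorem finrank_kaehlerDifferential_le_ringKrullDim (k O : Type*) [Field k] [CharZero k]
    [CommRing O] [IsDomain O] [Algebra k O] [Algebra.FiniteType k O] :
    (Module.finrank O (Ω[O⁄k]) : WithBot ℕ∞) ≤ ringKrullDim O := by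
  -- Noether normalisation: the number `s` of variables bounds the rank from above and the dimension
  -- from below.
  obtain ⟨s, g, hg, hint⟩ := exists_integral_inj_algHom_of_fg k O
  let A := MvPolynomial (Fin s) k
  let : Algebra A O := g.toRingHom.toAlgebra
  have : IsScalarTower k A O := IsScalarTower.of_algebraMap_eq fun r => (g.commutes r).symm
  have : Algebra.IsIntegral A O := ⟨hint⟩
  have : Module.IsTorsionFree A O := Module.isTorsionFree_iff_algebraMap_injective.mpr hg
  have : CharZero A := charZero_of_injective_algebraMap (MvPolynomial.C_injective (Fin s) k)
  let b := KaehlerDifferential.mvPolynomialBasis k (Fin s)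
  have : Module.Free A (Ω[A⁄k]) := .of_basis b
  have : Module.Finite A (Ω[A⁄k]) := .of_basis b
  have h1 := finrank_kaehlerDifferential_le_of_isIntegral k A O
  rw [Module.finrank_eq_card_basis b, Fintype.card_fin] at h1
  have h2 := ringKrullDim_le_of_isIntegral A O hg
  rw [MvPolynomial.ringKrullDim_of_isNoetherianRing, ringKrullDim_eq_zero_of_field, zero_add,
    Nat.card_fin] at h2
  exact le_trans (by exact_mod_cast h1) h2

/-! ### The diagonal ideal is invertible -/

open Module in
/-- A finite projective module of rank at most one over a domain is locally generated by one
element. -/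
theorem exists_smul_mem_span_singleton_of_finrank_le_one {R M : Type*} [CommRing R] [IsDomain R]
    [AddCommGroup M] [Module R M] [Module.Finite R M] [Module.Projective R M]
    (h : finrank R M ≤ 1) (p : Ideal R) [p.IsPrime] :
    ∃ s ∉ p, ∃ t : M, ∀ x : M, s • x ∈ Submodule.span R {t} := by
  let Rp := Localization.AtPrime p
  let Mp := LocalizedModule p.primeCompl M
  -- Over a domain the local rank of a projective module equals its generic rank.
  have hr : finrank Rp Mp ≤ 1 := by
    change rankAtStalk M ⟨p, inferInstance⟩ ≤ 1
    rwa [← Ideal.finrank_fiber_eq_rankAtStalk, Ideal.finrank_fiber_eq_finrank]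
  have : Module.Free Rp Mp := free_of_flat_of_isLocalRing
  obtain ⟨v, hv⟩ := finrank_le_one_iff.mp hr
  induction v using LocalizedModule.induction_on with | _ t s
  have key (x : M) : ∃ u ∉ p, u • x ∈ Submodule.span R {t} := by
    obtain ⟨c, hc⟩ := hv (LocalizedModule.mk x 1)
    obtain ⟨a, b, rfl⟩ := IsLocalization.exists_mk'_eq p.primeCompl c
    rw [← Localization.mk_eq_mk', LocalizedModule.mk_smul_mk, LocalizedModule.mk_eq] at hc
    obtain ⟨u, hu⟩ := hc
    refine ⟨u * (b * s : p.primeCompl), (u * (b * s)).2, ?_⟩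
    rw [one_smul] at hu
    rw [Submodule.mem_span_singleton]
    exact ⟨u * a, by rw [mul_smul, mul_smul]; exact hu⟩
  obtain ⟨S, hS⟩ := Module.Finite.fg_top (R := R) (M := M)
  choose u hu hut using key
  refine ⟨∏ x ∈ S, u x, fun hmem => ?_, t, fun x => ?_⟩
  · obtain ⟨x, -, hx⟩ := (Ideal.IsPrime.prod_mem_iff).mp hmem
    exact hu x hx
  · have : (⊤ : Submodule R M) ≤
        (Submodule.span R {t}).comap (LinearMap.lsmul R M (∏ x ∈ S, u x)) := by
      rw [← hS, Submodule.span_le]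
      intro y hy
      obtain ⟨c, hc⟩ := Finset.dvd_prod_of_mem u hy
      rw [SetLike.mem_coe, Submodule.mem_comap, LinearMap.lsmul_apply]
      rw [hc, mul_comm, mul_smul]
      exact Submodule.smul_mem _ _ (hut y)
    exact this trivial

open Polynomial in
/-- If `s • J ⊆ R t + J²` for a finitely generated ideal `J` contained in a prime `M ∌ s`, then
`u • J ⊆ R t` for some `u ∉ M`. -/
theorem Ideal.exists_smul_mem_span_singleton_of_le_sq {R : Type*} [CommRing R] (J M : Ideal R)
    [M.IsPrime] (hJM : J ≤ M) (hJ : J.FG) (s : R) (hs : s ∉ M) (t : R) (ht : t ∈ J)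
    (h : ∀ j ∈ J, ∃ c, s * j - c * t ∈ J ^ 2) :
    ∃ u ∉ M, ∀ j ∈ J, ∃ c, u * j = c * t := by
  let T : Submodule R J := Submodule.span R {⟨t, ht⟩}
  have : Module.Finite R J := Module.Finite.iff_fg.mpr hJ
  -- Nakayama by the determinant trick: `s` maps `J/Rt` into `J · (J/Rt)`, so Cayley–Hamilton gives
  -- a monic `p` with lower coefficients in `J` such that `p(s)` kills `J/Rt`. The witness is `u =
  -- p(s)`.
  have hrange : LinearMap.range (algebraMap R (Module.End R (J ⧸ T)) s) ≤ J • ⊤ := by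
    rintro _ ⟨x, rfl⟩
    obtain ⟨j, rfl⟩ := T.mkQ_surjective x
    obtain ⟨c, hc⟩ := h j j.2
    have hmem : s • j - c • (⟨t, ht⟩ : J) ∈ (J • ⊤ : Submodule R J) := by
      rw [Submodule.mem_smul_top_iff, smul_eq_mul, ← pow_two]
      exact hc
    have h2 := Submodule.mem_map_of_mem (f := T.mkQ) hmem
    rw [Submodule.map_smul'', Submodule.map_top, Submodule.range_mkQ] at h2
    have h3 : T.mkQ (s • j - c • (⟨t, ht⟩ : J)) = s • T.mkQ j := by
      have : T.mkQ (c • (⟨t, ht⟩ : J)) = 0 :=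
        (Submodule.Quotient.mk_eq_zero T).mpr
          (T.smul_mem c (Submodule.mem_span_singleton_self _))
      rw [map_sub, this, sub_zero, map_smul]
    rwa [h3] at h2
  obtain ⟨p, hp, -, hcoeff, haeval⟩ :=
    LinearMap.exists_monic_and_natDegree_eq_and_coeff_mem_pow_and_aeval_eq_zero R _ J hrange
  rw [aeval_algebraMap_apply] at haeval
  refine ⟨aeval s p, fun hu => ?_, fun j hj => ?_⟩
  -- The lower coefficients vanish modulo `M`, so `p(s)` is a power of `s` there.
  · have hmap : p.map (Ideal.Quotient.mk M) = X ^ p.natDegree := by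
      ext i
      rw [coeff_map, coeff_X_pow]
      split_ifs with hi
      · rw [hi, coeff_natDegree, hp.leadingCoeff, map_one]
      · rw [Ideal.Quotient.eq_zero_iff_mem]
        rcases lt_or_gt_of_ne hi with hi | hi
        · exact hJM (Ideal.pow_le_self (Nat.sub_ne_zero_of_lt hi) (hcoeff i))
        · rw [coeff_eq_zero_of_natDegree_lt hi]; exact M.zero_mem
    have h0 : eval (Ideal.Quotient.mk M s) (p.map (Ideal.Quotient.mk M)) = 0 := by
      rw [eval_map_apply, Ideal.Quotient.eq_zero_iff_mem]
      exact hu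
    rw [hmap, eval_pow, eval_X] at h0
    exact hs (Ideal.Quotient.eq_zero_iff_mem.mp (by_contra fun h1 => pow_ne_zero _ h1 h0))
  · have h1 := congrArg (fun f => f (T.mkQ ⟨j, hj⟩)) haeval
    have h2 : aeval s p • (⟨j, hj⟩ : J) ∈ T := (Submodule.Quotient.mk_eq_zero T).mp h1
    obtain ⟨c, hc⟩ := Submodule.mem_span_singleton.mp h2
    exact ⟨c, (congrArg Subtype.val hc).symm⟩

/-- An ideal `J` of a domain is invertible, in the sense that the inclusion of `J` lies in
`J • Hom(J, R)`, as soon as it is locally principal at all primes containing it. -/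
theorem Ideal.subtype_mem_smul_top_of_locally_principal {R : Type*} [CommRing R] [IsDomain R]
    (J : Ideal R)
    (h : ∀ M : Ideal R, M.IsMaximal → J ≤ M →
      ∃ u ∉ M, ∃ t ∈ J, ∀ j ∈ J, ∃ c, u * j = c * t) :
    J.subtype ∈ (J • ⊤ : Submodule R (J →ₗ[R] R)) := by
  -- The multipliers `r` for which `r` times the inclusion lies in `J • Hom(J, R)`. They include
  -- `J`, so only maximal ideals containing `J` need to be excluded.
  let 𝔞 : Ideal R := (J • ⊤ : Submodule R (J →ₗ[R] R)).comap
    (LinearMap.toSpanSingleton R (J →ₗ[R] R) J.subtype)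
  have ha (r : R) : r ∈ 𝔞 ↔ r • J.subtype ∈ (J • ⊤ : Submodule R (J →ₗ[R] R)) := Iff.rfl
  suffices 𝔞 = ⊤ by
    have h1 := (Ideal.eq_top_iff_one 𝔞).mp this
    rwa [ha, one_smul] at h1
  by_contra hne
  obtain ⟨M, hM, hle⟩ := Ideal.exists_le_maximal 𝔞 hne
  have hJa : J ≤ 𝔞 := fun r hr => Submodule.smul_mem_smul hr trivial
  obtain ⟨u, hu, t, ht, hut⟩ := h M hM (hJa.trans hle)
  refine hu (hle ?_)
  rw [ha]
  by_cases ht0 : t = 0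
  · have : u • J.subtype = 0 := by
      ext j
      obtain ⟨c, hc⟩ := hut j j.2
      simpa [ht0] using hc
    rw [this]
    exact Submodule.zero_mem _
  · choose c hc using hut
    -- Division of `u * j` by the local generator `t`, so that `u` times the inclusion is `t • D`.
    let D : J →ₗ[R] R :=
      { toFun := fun j => c j j.2
        map_add' := fun j j' => by
          apply mul_right_cancel₀ ht0
          rw [← hc, add_mul, ← hc, ← hc, ← mul_add]; rfl
        map_smul' := fun r j => by
          apply mul_right_cancel₀ ht0
          rw [← hc, RingHom.id_apply, smul_eq_mul, mul_assoc, ← hc]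
          simp only [SetLike.val_smul, smul_eq_mul]; ring }
    have : u • J.subtype = t • D := by
      ext j
      change u * j = t * c j j.2
      rw [hc j j.2, mul_comm]
    rw [this]
    exact Submodule.smul_mem_smul ht trivial

/-- The ideal of the diagonal of a smooth affine curve is invertible. -/
theorem KaehlerDifferential.ideal_subtype_mem_smul_top (k O : Type*) [Field k] [IsAlgClosed k]
    [CharZero k] [CommRing O] [IsDomain O] [Algebra k O] [Algebra.Smooth k O]
    (hdim : ringKrullDim O ≤ 1) :
    (KaehlerDifferential.ideal k O).subtype ∈ (KaehlerDifferential.ideal k O • ⊤ :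
      Submodule (O ⊗[k] O) (KaehlerDifferential.ideal k O →ₗ[O ⊗[k] O] (O ⊗[k] O))) := by
  have : Algebra.FiniteType k O := inferInstance
  have : IsDomain (O ⊗[k] O) := isDomain_tensorProduct_of_isAlgClosed k O O
  apply Ideal.subtype_mem_smul_top_of_locally_principal
  intro M hM hJM
  have hr : Module.finrank O (Ω[O⁄k]) ≤ 1 := by
    have := (finrank_kaehlerDifferential_le_ringKrullDim k O).trans hdim
    exact_mod_cast this
  let inc : O →ₐ[k] O ⊗[k] O := Algebra.TensorProduct.includeLeft
  have : (M.comap inc).IsPrime := Ideal.comap_isPrime inc M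
  obtain ⟨s, hs, ω, hω⟩ :=
    exists_smul_mem_span_singleton_of_finrank_le_one (M := Ω[O⁄k]) hr (M.comap inc)
  obtain ⟨t, rfl⟩ := KaehlerDifferential.fromIdeal_surjective k O ω
  -- Under `Ω = J/J²`, with scalars acting through the left factor, `hω` says that `s • J ⊆ R t +
  -- J²` for `R = O ⊗ O`.
  obtain ⟨u, hu, h⟩ := Ideal.exists_smul_mem_span_singleton_of_le_sq
    (KaehlerDifferential.ideal k O) M hJM (KaehlerDifferential.ideal_fg k O) (inc s) hs t t.2
    (fun j hj => by
      obtain ⟨c, hc⟩ := Submodule.mem_span_singleton.mp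
        (hω (KaehlerDifferential.fromIdeal k O ⟨j, hj⟩))
      refine ⟨inc c, ?_⟩
      have hsm (a : O) (x : KaehlerDifferential.ideal k O) :
          a • KaehlerDifferential.fromIdeal k O x =
            KaehlerDifferential.fromIdeal k O (inc a • x) := by
        rw [map_smul, ← algebraMap_smul (O ⊗[k] O) a]; rfl
      rw [hsm, hsm, eq_comm] at hc
      exact (Ideal.toCotangent_eq _).mp hc)
  exact ⟨u, hu, t, t.2, h⟩

/-! ### Double derivations modulo commutators -/

namespace DoubleDer

variable (k A : Type*) [CommRing k] [Ring A] [Algebra k A]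

/-- The additive subgroup `[A, Der(A, A ⊗ A)]` of the bimodule of double derivations. -/
def commutators : AddSubgroup (DoubleDer k A) :=
  AddSubgroup.closure
    (Set.range fun p : A × DoubleDer k A => p.1 • p.2 - MulOpposite.op p.1 • p.2)

variable {k A}

theorem smul_sub_op_smul_mem_commutators (a : A) (d : DoubleDer k A) :
    a • d - MulOpposite.op a • d ∈ commutators k A :=
  AddSubgroup.subset_closure ⟨(a, d), rfl⟩

/-- Evaluation of double derivations at an element. -/
def evalHom (x : A) : DoubleDer k A →+ A ⊗[k] A where
  toFun d := d.toLin x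
  map_zero' := rfl
  map_add' _ _ := rfl

variable (k A) in
/-- The inner double derivation `x ↦ x.ω - ω.x`. -/
def inner : A ⊗[k] A →+ DoubleDer k A where
  toFun ω :=
    { toLin := LinearMap.mulRight k ω ∘ₗ (TensorProduct.mk k A A).flip 1 -
        LinearMap.mulLeft k ω ∘ₗ TensorProduct.mk k A A 1
      leibniz := fun a b => by
        have h1 : (a * b) ⊗ₜ[k] (1 : A) = (a ⊗ₜ 1) * (b ⊗ₜ 1) := by simp
        have h2 : (1 : A) ⊗ₜ[k] (a * b) = (1 ⊗ₜ a) * (1 ⊗ₜ b) := by simp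
        simp only [LinearMap.sub_apply, LinearMap.comp_apply, LinearMap.flip_apply,
          TensorProduct.mk_apply, LinearMap.mulRight_apply, LinearMap.mulLeft_apply, h1, h2,
          mul_sub, sub_mul, mul_assoc]
        abel }
  map_zero' := by ext; simp
  map_add' ω ω' := by ext; simp [mul_add, add_mul]; abel

theorem inner_toLin (ω : A ⊗[k] A) (x : A) :
    (inner k A ω).toLin x = (x ⊗ₜ 1) * ω - ω * (1 ⊗ₜ x) := rfl

theorem inner_one : inner k A 1 = Delta k A := by
  ext x
  simp [inner_toLin, Delta]

theorem smul_inner (a : A) (ω : A ⊗[k] A) : a • inner k A ω = inner k A ((1 ⊗ₜ a) * ω) := by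
  ext x
  simp only [toLin_smul, inner_toLin, mul_sub, ← mul_assoc, Algebra.TensorProduct.tmul_mul_tmul,
    one_mul, mul_one]

theorem op_smul_inner (a : A) (ω : A ⊗[k] A) :
    MulOpposite.op a • inner k A ω = inner k A (ω * (a ⊗ₜ 1)) := by
  ext x
  simp only [toLin_op_smul, inner_toLin, sub_mul, mul_assoc, Algebra.TensorProduct.tmul_mul_tmul,
    one_mul, mul_one, MulOpposite.unop_op]

/-- The commutator of `a` with this inner derivation is its negative: the left action produces `a *
b = 0` in the second slot, the right action `a * a = a` in the first. -/
theorem inner_tmul_mem_commutators {a b : A} (ha : a * a = a) (hab : a * b = 0) :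
    inner k A (a ⊗ₜ b) ∈ commutators k A := by
  have h := smul_sub_op_smul_mem_commutators a (inner k A (a ⊗ₜ[k] b))
  rw [smul_inner, op_smul_inner, Algebra.TensorProduct.tmul_mul_tmul, hab, TensorProduct.tmul_zero,
    map_zero, Algebra.TensorProduct.tmul_mul_tmul, ha, mul_one, zero_sub] at h
  exact neg_mem_iff.mp h

end DoubleDer

/-! ### Double derivations of the one-point extension -/

namespace OnePointExt

set_option linter.unusedSectionVars false

section Ring

variable {k A I : Type*} [CommRing k] [Ring A] [Algebra k A]
  [AddCommGroup I] [Module k I] [Module A I] [IsScalarTower k A I]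

@[simp] theorem corner_smul (r : k) (x : OnePointExt k A I) :
    (r • x).corner = r • x.corner := (Algebra.smul_def r x.corner).symm

@[simp] theorem vec_smul (r : k) (x : OnePointExt k A I) : (r • x).vec = r • x.vec := by
  change algebraMap k A r • x.vec + x.scal • (0 : I) = r • x.vec
  simp

@[simp] theorem scal_smul (r : k) (x : OnePointExt k A I) : (r • x).scal = r • x.scal := rfl

variable (k A I) in
/-- The inclusion of the upper left corner. -/
def ofCorner : A →ₗ[k] OnePointExt k A I where
  toFun a := ⟨a, 0, 0⟩
  map_add' a b := by ext <;> simp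
  map_smul' r a := by ext <;> simp

variable (k A I) in
/-- The inclusion of the upper right entry. -/
def ofVec : I →ₗ[k] OnePointExt k A I where
  toFun v := ⟨0, v, 0⟩
  map_add' a b := by ext <;> simp
  map_smul' r a := by ext <;> simp

variable (k A I) in
/-- The projection to the upper left corner. -/
def cornerₗ : OnePointExt k A I →ₗ[k] A where
  toFun x := x.corner
  map_add' _ _ := rfl
  map_smul' := corner_smul

variable (k A I) in
/-- The projection to the upper right entry. -/
def vecₗ : OnePointExt k A I →ₗ[k] I where
  toFun x := x.vec
  map_add' _ _ := rfl
  map_smul' := vec_smul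

theorem e_mul_e : e k A I * e k A I = e k A I := by ext <;> simp [e]

theorem eInf_mul_eInf : eInf k A I * eInf k A I = eInf k A I := by ext <;> simp [eInf]

theorem e_mul_eInf : e k A I * eInf k A I = 0 := by ext <;> simp [e, eInf]

theorem eInf_mul_e : eInf k A I * e k A I = 0 := by ext <;> simp [e, eInf]

theorem e_add_eInf : e k A I + eInf k A I = 1 := by ext <;> simp [e, eInf]

theorem mul_ofCorner (x : OnePointExt k A I) (a : A) :
    x * ofCorner k A I a = ofCorner k A I (x.corner * a) := by ext <;> simp [ofCorner]

theorem ofCorner_mul (x : OnePointExt k A I) (a : A) :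
    ofCorner k A I a * x = ofCorner k A I (a * x.corner) + ofVec k A I (a • x.vec) := by
  ext <;> simp [ofCorner, ofVec]

theorem ofVec_mul (x : OnePointExt k A I) (v : I) :
    ofVec k A I v * x = x.scal • ofVec k A I v := by ext <;> simp [ofVec]

theorem ofCorner_mul_ofCorner (a b : A) :
    ofCorner k A I a * ofCorner k A I b = ofCorner k A I (a * b) := mul_ofCorner _ _

theorem ofCorner_mul_ofVec (a : A) (v : I) :
    ofCorner k A I a * ofVec k A I v = ofVec k A I (a • v) := by ext <;> simp [ofCorner, ofVec]

end Ring

variable {k O I : Type*} [CommRing k] [CommRing O] [Algebra k O]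
  [AddCommGroup I] [Module k I] [Module O I] [IsScalarTower k O I]

noncomputable section

variable (k O) in
/-- The universal double derivation `a ↦ a ⊗ 1 - 1 ⊗ a` into the ideal of the diagonal. -/
def diag : O →ₗ[k] KaehlerDifferential.ideal k O where
  toFun a := ⟨a ⊗ₜ 1 - 1 ⊗ₜ a, by simp [RingHom.mem_ker]⟩
  map_add' a b := by ext; simp [TensorProduct.add_tmul, TensorProduct.tmul_add]; abel
  map_smul' r a := by ext; simp [TensorProduct.smul_tmul', smul_sub]

theorem diag_mul (a b : O) :
    diag k O (a * b) = (a ⊗ₜ[k] (1 : O)) • diag k O b + ((1 : O) ⊗ₜ[k] b) • diag k O a := by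
  ext
  simp [diag, mul_sub, mul_comm b]

variable (k O I) in
/-- The inclusion `O ⊗ O → O[I] ⊗ O[I]`. -/
def cornerTensor : O ⊗[k] O →ₗ[k] OnePointExt k O I ⊗[k] OnePointExt k O I :=
  TensorProduct.map (ofCorner k O I) (ofCorner k O I)

theorem tmul_one_mul_cornerTensor (x : OnePointExt k O I) (t : O ⊗[k] O) :
    (x ⊗ₜ 1) * cornerTensor k O I t = cornerTensor k O I ((x.corner ⊗ₜ 1) * t) := by
  induction t with
  | zero => simp
  | add t s ht hs => rw [map_add, mul_add, mul_add, map_add, ht, hs]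
  | tmul a b => simp [cornerTensor, mul_ofCorner]

theorem one_tmul_mul_cornerTensor (x : OnePointExt k O I) (t : O ⊗[k] O) :
    (1 ⊗ₜ x) * cornerTensor k O I t = cornerTensor k O I ((1 ⊗ₜ x.corner) * t) := by
  induction t with
  | zero => simp
  | add t s ht hs => rw [map_add, mul_add, mul_add, map_add, ht, hs]
  | tmul a b => simp [cornerTensor, mul_ofCorner]

theorem cornerTensor_mul_ofCorner_tmul_one (a : O) (t : O ⊗[k] O) :
    cornerTensor k O I t * (ofCorner k O I a ⊗ₜ 1) = cornerTensor k O I ((a ⊗ₜ 1) * t) := by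
  induction t with
  | zero => simp
  | add t s ht hs => rw [map_add, add_mul, mul_add, map_add, ht, hs]
  | tmul b c => simp [cornerTensor, ofCorner_mul_ofCorner, mul_comm]

theorem cornerTensor_mul_one_tmul_ofCorner (a : O) (t : O ⊗[k] O) :
    cornerTensor k O I t * (1 ⊗ₜ ofCorner k O I a) = cornerTensor k O I ((1 ⊗ₜ a) * t) := by
  induction t with
  | zero => simp
  | add t s ht hs => rw [map_add, add_mul, mul_add, map_add, ht, hs]
  | tmul b c => simp [cornerTensor, ofCorner_mul_ofCorner, mul_comm]

/-- A corner entry multiplied on the right acquires a vector component. In the Leibniz rule for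
`extendDer` this extra term is matched by the sum over the dual basis. -/
theorem cornerTensor_mul_one_tmul (x : OnePointExt k O I) (t : O ⊗[k] O) :
    cornerTensor k O I t * (1 ⊗ₜ x) = cornerTensor k O I ((1 ⊗ₜ x.corner) * t) +
      cornerTensor k O I t * (1 ⊗ₜ ofVec k O I x.vec) := by
  induction t with
  | zero => simp
  | add t s ht hs =>
    rw [map_add, add_mul, add_mul, mul_add, map_add, ht, hs]; abel
  | tmul b c =>
    simp only [cornerTensor, TensorProduct.map_tmul, Algebra.TensorProduct.tmul_mul_tmul, mul_one,
      one_mul, ofCorner_mul x c, ofCorner_mul_ofVec, mul_comm c, TensorProduct.tmul_add]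

variable {ι : Type*} [Fintype ι] (y : ι → I) (f : ι → I →ₗ[O] O)

/-- The extension of a double derivation of `O` to `O[I]` along the Grassmann connection of a dual
basis `(y, f)` of `I`. -/
def extendDer (hyf : ∀ v, ∑ i, f i v • y i = v) :
    (KaehlerDifferential.ideal k O →ₗ[O ⊗[k] O] (O ⊗[k] O)) →+
      DoubleDer k (OnePointExt k O I) where
  toFun D :=
    { toLin := cornerTensor k O I ∘ₗ (D.restrictScalars k ∘ₗ diag k O) ∘ₗ cornerₗ k O I +
        ∑ i, LinearMap.mulRight k (1 ⊗ₜ ofVec k O I (y i)) ∘ₗ cornerTensor k O I ∘ₗ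
          (D.restrictScalars k ∘ₗ diag k O) ∘ₗ (f i).restrictScalars k ∘ₗ vecₗ k O I
      leibniz := fun x x' => by
        have hD (a b : O) : D (diag k O (a * b)) =
            (a ⊗ₜ 1) * D (diag k O b) + (1 ⊗ₜ b) * D (diag k O a) := by
          rw [diag_mul, map_add, map_smul, map_smul, smul_eq_mul, smul_eq_mul]
        have hsum : ∑ i, cornerTensor k O I ((1 ⊗ₜ f i x'.vec) * D (diag k O x.corner)) *
            (1 ⊗ₜ ofVec k O I (y i)) =
            cornerTensor k O I (D (diag k O x.corner)) * (1 ⊗ₜ ofVec k O I x'.vec) := by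
          simp only [← cornerTensor_mul_one_tmul_ofCorner, mul_assoc,
            Algebra.TensorProduct.tmul_mul_tmul, one_mul, ofCorner_mul_ofVec]
          rw [← Finset.mul_sum, ← TensorProduct.tmul_sum, ← map_sum, hyf]
        have hY (t : OnePointExt k O I ⊗[k] OnePointExt k O I) (i : ι) :
            t * (1 ⊗ₜ ofVec k O I (y i)) * (1 ⊗ₜ x') =
              x'.scal • (t * (1 ⊗ₜ ofVec k O I (y i))) := by
          rw [mul_assoc, Algebra.TensorProduct.tmul_mul_tmul, one_mul, ofVec_mul,
            TensorProduct.tmul_smul, mul_smul_comm]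
        simp only [cornerₗ, vecₗ, LinearMap.add_apply, LinearMap.comp_apply, LinearMap.sum_apply,
          LinearMap.mulRight_apply, LinearMap.restrictScalars_apply, LinearMap.coe_mk,
          AddHom.coe_mk, corner_mul, vec_mul, map_add, map_smul, smul_eq_mul, hD,
          add_mul, Finset.sum_add_distrib, hsum,
          mul_add, Finset.mul_sum, Finset.sum_mul, hY]
        simp only [← mul_assoc, tmul_one_mul_cornerTensor]
        rw [cornerTensor_mul_one_tmul x']
        abel }
  map_zero' := by
    ext x
    simp
  map_add' D D' := by
    ext x
    simp [add_mul, Finset.sum_add_distrib]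
    abel

variable {y f} (hyf : ∀ v, ∑ i, f i v • y i = v)

theorem extendDer_toLin (D : KaehlerDifferential.ideal k O →ₗ[O ⊗[k] O] (O ⊗[k] O))
    (x : OnePointExt k O I) : (extendDer y f hyf D).toLin x =
      cornerTensor k O I (D (diag k O x.corner)) +
      ∑ i, cornerTensor k O I (D (diag k O (f i x.vec))) * (1 ⊗ₜ ofVec k O I (y i)) := by
  simp [extendDer, cornerₗ, vecₗ]

/-- For `p = a ⊗ b` the extension of `p • D` is obtained from that of `D` by acting with `b` on the
left and `a` on the right. Modulo commutators `a` moves to the left, which leaves the action of `a *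
b`. -/
theorem extendDer_smul_sub_mem_commutators
    (D : KaehlerDifferential.ideal k O →ₗ[O ⊗[k] O] (O ⊗[k] O)) (p : O ⊗[k] O) :
    extendDer y f hyf (p • D) -
      ofCorner k O I (Algebra.TensorProduct.lmul' k p) • extendDer y f hyf D ∈
        DoubleDer.commutators k (OnePointExt k O I) := by
  induction p with
  | zero => simp
  | add p q hp hq =>
    have := add_mem hp hq
    rw [add_smul, map_add, map_add, map_add, add_smul]
    convert this using 1
    abel
  | tmul a b =>
    have h := neg_mem (DoubleDer.smul_sub_op_smul_mem_commutators (ofCorner k O I a)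
      (ofCorner k O I b • extendDer y f hyf D))
    convert h using 1
    rw [neg_sub, smul_smul, ofCorner_mul_ofCorner, Algebra.TensorProduct.lmul'_apply_tmul]
    congr 1
    ext x
    have key (t : O ⊗[k] O) : cornerTensor k O I ((a ⊗ₜ[k] b) * t) =
        (1 ⊗ₜ ofCorner k O I b) * cornerTensor k O I t * (ofCorner k O I a ⊗ₜ 1) := by
      rw [one_tmul_mul_cornerTensor, cornerTensor_mul_ofCorner_tmul_one, ← mul_assoc]
      simp [ofCorner]
    have hc (v : I) : (ofCorner k O I a ⊗ₜ[k] (1 : OnePointExt k O I)) * (1 ⊗ₜ ofVec k O I v) =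
        (1 ⊗ₜ ofVec k O I v) * (ofCorner k O I a ⊗ₜ 1) := by simp
    simp only [DoubleDer.toLin_op_smul, DoubleDer.toLin_smul, extendDer_toLin, LinearMap.smul_apply,
      smul_eq_mul, key, MulOpposite.unop_op, mul_add, add_mul, Finset.mul_sum, Finset.sum_mul,
      mul_assoc, hc]

theorem extendDer_mem_commutators
    {D : KaehlerDifferential.ideal k O →ₗ[O ⊗[k] O] (O ⊗[k] O)}
    (hD : D ∈ (KaehlerDifferential.ideal k O • ⊤ :
      Submodule (O ⊗[k] O) (KaehlerDifferential.ideal k O →ₗ[O ⊗[k] O] (O ⊗[k] O)))) :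
    extendDer y f hyf D ∈ DoubleDer.commutators k (OnePointExt k O I) := by
  induction hD using Submodule.smul_induction_on' with
  | smul p hp D _ =>
    have h := extendDer_smul_sub_mem_commutators hyf D p
    -- The diagonal ideal is the kernel of multiplication.
    have hp' : Algebra.TensorProduct.lmul' k p = 0 := hp
    rwa [hp', map_zero, zero_smul, sub_zero] at h
  | add D _ D' _ h h' => rw [map_add]; exact add_mem h h'

/-- The double derivation of `O[I]` which vanishes on `O` and maps `v ∈ I` to `g v ⊗ e_∞`. -/
def vecDer (g : I →ₗ[O] O) : DoubleDer k (OnePointExt k O I) where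
  toLin := (TensorProduct.mk k _ _).flip (eInf k O I) ∘ₗ ofCorner k O I ∘ₗ
    g.restrictScalars k ∘ₗ vecₗ k O I
  leibniz x x' := by
    have h : eInf k O I * x' = x'.scal • eInf k O I := by ext <;> simp [eInf]
    simp only [vecₗ, LinearMap.comp_apply, LinearMap.flip_apply, TensorProduct.mk_apply,
      LinearMap.restrictScalars_apply, LinearMap.coe_mk, AddHom.coe_mk, vec_mul, map_add, map_smul,
      LinearMap.map_smul_of_tower g, Algebra.TensorProduct.tmul_mul_tmul, one_mul, mul_one,
      mul_ofCorner, h, TensorProduct.tmul_smul, TensorProduct.smul_tmul',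
      smul_eq_mul]

theorem vecDer_toLin (g : I →ₗ[O] O) (x : OnePointExt k O I) :
    (vecDer g).toLin x = ofCorner k O I (g x.vec) ⊗ₜ[k] eInf k O I := rfl

/-- Splitting `1 ⊗ 1` along `1 = e + e_∞` cuts `Δ` into four inner derivations. The two mixed ones
are commutators; the other two together are the extended inclusion of the diagonal ideal, up to
commutators with the `y i`. -/
theorem Delta_mem_commutators (hyf : ∀ v, ∑ i, f i v • y i = v)
    (hJ : (KaehlerDifferential.ideal k O).subtype ∈ (KaehlerDifferential.ideal k O • ⊤ :
      Submodule (O ⊗[k] O) (KaehlerDifferential.ideal k O →ₗ[O ⊗[k] O] (O ⊗[k] O)))) :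
    DoubleDer.Delta k (OnePointExt k O I) ∈ DoubleDer.commutators k (OnePointExt k O I) := by
  -- On `v ∈ I` the extended inclusion gives `∑ f i v ⊗ y i - e ⊗ v`; subtracting the commutators
  -- replaces the sum by `v ⊗ e_∞`.
  have h1 : DoubleDer.inner k _ (e k O I ⊗ₜ e k O I) +
      DoubleDer.inner k _ (eInf k O I ⊗ₜ eInf k O I) =
      extendDer y f hyf (KaehlerDifferential.ideal k O).subtype -
        ∑ i, (ofVec k O I (y i) • vecDer (f i) -
          MulOpposite.op (ofVec k O I (y i)) • vecDer (f i)) := by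
    ext x
    have he1 : x * e k O I = ofCorner k O I x.corner := by ext <;> simp [e, ofCorner]
    have he2 : e k O I * x = ofCorner k O I x.corner + ofVec k O I x.vec := by
      ext <;> simp [e, ofCorner, ofVec]
    have hi1 : x * eInf k O I = ofVec k O I x.vec + x.scal • eInf k O I := by
      ext <;> simp [eInf, ofVec]
    have hi2 : eInf k O I * x = x.scal • eInf k O I := by ext <;> simp [eInf]
    have hi3 (i : ι) : ofVec k O I (y i) * eInf k O I = ofVec k O I (y i) := by
      ext <;> simp [eInf, ofVec]
    have he3 (v : I) : e k O I * ofVec k O I v = ofVec k O I v := by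
      ext <;> simp [e, ofVec]
    have he4 : ofCorner k O I 1 = e k O I := rfl
    have hdiag (a : O) : (diag k O a : O ⊗[k] O) = a ⊗ₜ 1 - 1 ⊗ₜ a := rfl
    have hsum : ∑ i, ofVec k O I (f i x.vec • y i) = ofVec k O I x.vec := by
      rw [← map_sum, hyf]
    have heval (d d' : DoubleDer k (OnePointExt k O I))
        (h : DoubleDer.evalHom x d = DoubleDer.evalHom x d') : d.toLin x = d'.toLin x := h
    apply heval
    simp only [map_add, map_sub, map_sum]
    simp only [DoubleDer.evalHom, AddMonoidHom.coe_mk, ZeroHom.coe_mk, DoubleDer.inner_toLin,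
      extendDer_toLin, DoubleDer.toLin_smul, DoubleDer.toLin_op_smul, vecDer_toLin,
      MulOpposite.unop_op, Algebra.TensorProduct.tmul_mul_tmul, one_mul, mul_one,
      he1, he2, hi1, hi2, hi3, Submodule.subtype_apply, hdiag, map_sub, cornerTensor,
      TensorProduct.map_tmul, sub_mul, he4, he3, ofCorner_mul_ofVec, Finset.sum_sub_distrib,
      TensorProduct.add_tmul, TensorProduct.tmul_add, TensorProduct.smul_tmul,
      ← TensorProduct.tmul_sum, ← TensorProduct.sum_tmul, hsum]
    abel
  rw [← DoubleDer.inner_one, Algebra.TensorProduct.one_def, ← e_add_eInf, TensorProduct.add_tmul,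
    TensorProduct.tmul_add, TensorProduct.tmul_add, map_add, map_add, map_add]
  have h2 := DoubleDer.inner_tmul_mem_commutators (k := k) (e_mul_e (k := k) (A := O) (I := I))
    e_mul_eInf
  have h3 := DoubleDer.inner_tmul_mem_commutators (k := k) (eInf_mul_eInf (k := k) (A := O) (I := I))
    eInf_mul_e
  have h4 := sub_mem (extendDer_mem_commutators hyf hJ)
    (sum_mem fun i (_ : i ∈ Finset.univ) => DoubleDer.smul_sub_op_smul_mem_commutators
      (ofVec k O I (y i)) (vecDer (f i)))
  rw [← h1] at h4
  convert add_mem (add_mem h4 h2) h3 using 1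
  abel

end

end OnePointExt

/-! ### Traces on modules over the deformed preprojective algebra -/

namespace DefPreproj

section

variable (k : Type*) {A : Type*} [CommRing k] [Ring A] [Algebra k A] (lam : A)

/-- The canonical map `Der(A, A ⊗ A) → Π^λ(A)`. -/
def ofDer : DoubleDer k A →+ DefPreproj k lam :=
  (RingQuot.mkAlgHom k (DefPreproj.Rel k lam)).toRingHom.toAddMonoidHom.comp
    (BimodTensorAlgebra.ofBimod k A (DoubleDer k A))

theorem ofDer_smul (a : A) (d : DoubleDer k A) :
    ofDer k lam (a • d) = ofBase k lam a * ofDer k lam d := by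
  have h := RingQuot.mkAlgHom_rel k (BimodTensorAlgebra.Rel.left_smul (k := k) a d)
  rw [map_mul] at h
  exact (congrArg (RingQuot.mkAlgHom k (DefPreproj.Rel k lam)) h).trans (map_mul _ _ _)

theorem ofDer_op_smul (a : A) (d : DoubleDer k A) :
    ofDer k lam (MulOpposite.op a • d) = ofDer k lam d * ofBase k lam a := by
  have h := RingQuot.mkAlgHom_rel k (BimodTensorAlgebra.Rel.right_smul (k := k) d a)
  rw [map_mul] at h
  exact (congrArg (RingQuot.mkAlgHom k (DefPreproj.Rel k lam)) h).trans (map_mul _ _ _)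

theorem ofDer_Delta : ofDer k lam (DoubleDer.Delta k A) = ofBase k lam lam :=
  RingQuot.mkAlgHom_rel k DefPreproj.Rel.delta

/-- If `Δ` is a sum of commutators, then `λ` has trace zero on every module over `Π^λ(A)`. -/
theorem trace_ofBase_eq_zero
    (hΔ : DoubleDer.Delta k A ∈ DoubleDer.commutators k A)
    (W : Type*) [AddCommGroup W] [Module k W] [Module (DefPreproj k lam) W]
    [IsScalarTower k (DefPreproj k lam) W] :
    LinearMap.trace k W (Algebra.lsmul k k W (ofBase k lam lam)) = 0 := by
  rw [← ofDer_Delta]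
  generalize DoubleDer.Delta k A = δ at hΔ
  induction hΔ using AddSubgroup.closure_induction with
  | mem x hx =>
    obtain ⟨⟨a, d⟩, rfl⟩ := hx
    -- Commutators have trace zero, also on `W` without a finite basis, where the trace is `0` by
    -- default.
    rw [map_sub, ofDer_smul, ofDer_op_smul, map_sub, map_mul, map_mul, map_sub,
      LinearMap.trace_mul_comm, sub_self]
  | zero => simp
  | add x y _ _ hx hy => rw [map_add, map_add, map_add, hx, hy, add_zero]
  | neg x _ hx => rw [map_neg, map_neg, map_neg, hx, neg_zero]

end

theorem ofBase_weight {k A I : Type*} [CommRing k] [Ring A] [Algebra k A]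
    [AddCommGroup I] [Module k I] [Module A I] [IsScalarTower k A I] {lam : OnePointExt k A I}
    (l lInf : k) (W : Type*) [AddCommGroup W] [Module k W] [Module (DefPreproj k lam) W]
    [IsScalarTower k (DefPreproj k lam) W] :
    LinearMap.trace k W (Algebra.lsmul k k W (ofBase k lam (OnePointExt.weight A I l lInf))) =
      l * LinearMap.trace k W (Algebra.lsmul k k W (ofBase k lam (OnePointExt.e k A I))) +
      lInf * LinearMap.trace k W
        (Algebra.lsmul k k W (ofBase k lam (OnePointExt.eInf k A I))) := by
  simp only [OnePointExt.weight, map_add, map_smul, smul_eq_mul]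

end DefPreproj

/-! ### Dimension vectors of submodules and simplicity -/

/-- The trace of an idempotent endomorphism is the dimension of its range. -/
theorem LinearMap.trace_eq_finrank_range_of_isIdempotentElem {k V : Type*} [Field k]
    [AddCommGroup V] [Module k V] [Module.Finite k V] {f : Module.End k V}
    (hf : IsIdempotentElem f) : LinearMap.trace k V f = Module.finrank k (LinearMap.range f) :=
  ((LinearMap.isProj_range_iff_isIdempotentElem f).mpr hf).trace

section Submodule

variable {k R V : Type*} [Field k] [Ring R] [Algebra k R] [AddCommGroup V] [Module k V]
  [Module R V] [IsScalarTower k R V] (W : Submodule R V) (a : R)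

theorem Submodule.map_range_lsmul_le :
    (LinearMap.range (Algebra.lsmul k k W a)).map (W.subtype.restrictScalars k) ≤
      LinearMap.range (Algebra.lsmul k k V a) := by
  rintro _ ⟨_, ⟨w, rfl⟩, rfl⟩
  exact ⟨w, rfl⟩

theorem Submodule.finrank_map_range_lsmul :
    Module.finrank k ((LinearMap.range (Algebra.lsmul k k W a)).map
      (W.subtype.restrictScalars k)) =
      Module.finrank k (LinearMap.range (Algebra.lsmul k k W a)) :=
  (Submodule.equivMapOfInjective (W.subtype.restrictScalars k) W.subtype_injective _).finrank_eq.symm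

variable [Module.Finite k V]

theorem Submodule.finrank_range_lsmul_le :
    Module.finrank k (LinearMap.range (Algebra.lsmul k k W a)) ≤
      Module.finrank k (LinearMap.range (Algebra.lsmul k k V a)) := by
  rw [← finrank_map_range_lsmul]
  exact Submodule.finrank_mono (W.map_range_lsmul_le a)

theorem Submodule.smul_mem_of_finrank_range_lsmul_eq
    (h : Module.finrank k (LinearMap.range (Algebra.lsmul k k W a)) =
      Module.finrank k (LinearMap.range (Algebra.lsmul k k V a))) (v : V) : a • v ∈ W := by
  rw [← finrank_map_range_lsmul] at h
  have hmem : a • v ∈ LinearMap.range (Algebra.lsmul k k V a) := ⟨v, rfl⟩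
  rw [← Submodule.eq_of_le_of_finrank_eq (W.map_range_lsmul_le a) h] at hmem
  obtain ⟨w, -, hw⟩ := hmem
  rw [← hw]
  exact w.2

theorem Submodule.smul_eq_zero_of_finrank_range_lsmul_eq_zero
    (h : Module.finrank k (LinearMap.range (Algebra.lsmul k k W a)) = 0) {w : V} (hw : w ∈ W) :
    a • w = 0 := by
  have : Module.Finite k W := Module.Finite.of_injective (W.subtype.restrictScalars k)
    W.subtype_injective
  rw [Submodule.finrank_eq_zero] at h
  have hmem : Algebra.lsmul k k W a ⟨w, hw⟩ ∈ LinearMap.range (Algebra.lsmul k k W a) := ⟨_, rfl⟩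
  rw [h, Submodule.mem_bot] at hmem
  exact congrArg Subtype.val hmem

end Submodule

/-- A module on which complementary idempotents `a`, `b` have ranks `n` and `1` is simple if the
traces of `a` and `b` on every module of the ring are related by `tr a = n tr b`. -/
theorem isSimpleModule_of_trace_eq.{v} {k R : Type*} {V : Type v} [Field k] [CharZero k] [Ring R]
    [Algebra k R] [AddCommGroup V] [Module k V] [Module R V] [IsScalarTower k R V]
    [Module.Finite k V] {a b : R} {n : ℕ} (hab : a + b = 1) (haa : IsIdempotentElem a)
    (hbb : IsIdempotentElem b)
    (hn : Module.finrank k (LinearMap.range (Algebra.lsmul k k V a)) = n)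
    (h1 : Module.finrank k (LinearMap.range (Algebra.lsmul k k V b)) = 1)
    (htr : ∀ (W : Type v) [AddCommGroup W] [Module k W] [Module R W] [IsScalarTower k R W],
      LinearMap.trace k W (Algebra.lsmul k k W a) =
        n * LinearMap.trace k W (Algebra.lsmul k k W b)) :
    IsSimpleModule R V := by
  have hnt : Nontrivial V := by
    by_contra h
    rw [not_nontrivial_iff_subsingleton] at h
    have h0 : Module.finrank k (LinearMap.range (Algebra.lsmul k k V b)) = 0 :=
      Module.finrank_zero_of_subsingleton
    omega
  rw [isSimpleModule_iff]
  refine { eq_bot_or_eq_top := fun W => ?_ }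
  have hWfin : Module.Finite k W := Module.Finite.of_injective (W.subtype.restrictScalars k)
    W.subtype_injective
  have htrW := htr W
  rw [LinearMap.trace_eq_finrank_range_of_isIdempotentElem (haa.map (Algebra.lsmul k k W)),
    LinearMap.trace_eq_finrank_range_of_isIdempotentElem (hbb.map (Algebra.lsmul k k W))] at htrW
  -- Characteristic zero turns the trace identity into an identity of dimensions.
  have hdim : Module.finrank k (LinearMap.range (Algebra.lsmul k k W a)) =
      n * Module.finrank k (LinearMap.range (Algebra.lsmul k k W b)) := by exact_mod_cast htrW
  have hle := W.finrank_range_lsmul_le (k := k) b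
  rw [h1] at hle
  rcases Nat.le_one_iff_eq_zero_or_eq_one.mp hle with h | h
  · left
    rw [h, mul_zero] at hdim
    refine (Submodule.eq_bot_iff W).mpr fun w hw => ?_
    rw [← one_smul R w, ← hab, add_smul,
      W.smul_eq_zero_of_finrank_range_lsmul_eq_zero a hdim hw,
      W.smul_eq_zero_of_finrank_range_lsmul_eq_zero b h hw, add_zero]
  · right
    rw [h, mul_one] at hdim
    refine eq_top_iff.mpr fun v _ => ?_
    rw [← one_smul R v, ← hab, add_smul]
    exact W.add_mem (W.smul_mem_of_finrank_range_lsmul_eq a (hdim.trans hn.symm) v)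
      (W.smul_mem_of_finrank_range_lsmul_eq b (h.trans h1.symm) v)

/-- If `Δ` is a sum of commutators in `Der(B, B ⊗ B)` for `B = A[I]`, then every module over
`Π^λ(B)`, `λ = (1, -n)`, of dimension vector `(n, 1)` is simple. -/
theorem HasDimVector.isSimpleModule {k A I : Type*} [Field k] [CharZero k] [Ring A] [Algebra k A]
    [AddCommGroup I] [Module k I] [Module A I] [IsScalarTower k A I] {n : ℕ}
    (hΔ : DoubleDer.Delta k (OnePointExt k A I) ∈ DoubleDer.commutators k (OnePointExt k A I))
    {lam : OnePointExt k A I} (hlam : lam = OnePointExt.weight A I (1 : k) (-(n : k)))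
    (V : Type*) [AddCommGroup V] [Module k V] [Module (DefPreproj k lam) V]
    [IsScalarTower k (DefPreproj k lam) V] (hV : HasDimVector (lam := lam) V n 1) :
    IsSimpleModule (DefPreproj k lam) V := by
  obtain ⟨hfin, hn, h1⟩ := hV
  refine isSimpleModule_of_trace_eq (k := k) ?_ ?_ ?_ hn h1 fun W _ _ _ _ => ?_
  · rw [← map_add, OnePointExt.e_add_eInf, map_one]
  · rw [IsIdempotentElem, ← map_mul, OnePointExt.e_mul_e]
  · rw [IsIdempotentElem, ← map_mul, OnePointExt.eInf_mul_eInf]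
  · have htr := DefPreproj.trace_ofBase_eq_zero k lam hΔ W
    have hw : DefPreproj.ofBase k lam lam = DefPreproj.ofBase k lam _ := congrArg _ hlam
    rw [hw, DefPreproj.ofBase_weight, one_mul, neg_mul, ← sub_eq_add_neg, sub_eq_zero] at htr
    exact htr

/-! ### Lifting representations -/

namespace DefPreproj

open Matrix

set_option linter.unusedSectionVars false

noncomputable section

variable {k A m : Type*} [Field k] [Ring A] [Algebra k A] [Fintype m] [DecidableEq m]

/-- The matrix representing a linear functional on matrices with respect to the trace form. -/
def traceDual (g : Matrix m m k →ₗ[k] k) : Matrix m m k :=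
  Matrix.of fun i j => g (Matrix.single j i 1)

theorem trace_traceDual_mul (g : Matrix m m k →ₗ[k] k) (T : Matrix m m k) :
    (traceDual g * T).trace = g T := by
  conv_rhs => rw [Matrix.matrix_eq_sum_single T]
  simp only [map_sum, Matrix.trace, Matrix.diag, Matrix.mul_apply, traceDual, Matrix.of_apply]
  rw [Finset.sum_comm]
  refine Finset.sum_congr rfl fun i _ => Finset.sum_congr rfl fun j _ => ?_
  have h : Matrix.single i j (T i j) = T i j • Matrix.single i j 1 := by
    rw [Matrix.smul_single, smul_eq_mul, mul_one]
  rw [h, map_smul, smul_eq_mul, mul_comm]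

theorem eq_of_trace_mul_eq {M N : Matrix m m k}
    (h : ∀ T : Matrix m m k, (M * T).trace = (N * T).trace) : M = N :=
  Matrix.ext_iff_trace_mul_right.mpr h

variable (ρ : A →ₐ[k] Matrix m m k)

/-- The linear map `x ⊗ y ↦ ρ x * T * ρ y`, as a function of `T`. -/
def sandwich : Matrix m m k →ₗ[k] A ⊗[k] A →ₗ[k] Matrix m m k where
  toFun T := TensorProduct.lift (LinearMap.mk₂ k (fun x y => ρ x * T * ρ y)
    (by intros; simp [add_mul]) (by intros; simp) (by intros; simp [mul_add]) (by intros; simp))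
  map_add' T T' := by ext; simp [add_mul, mul_add]
  map_smul' r T := by ext; simp

theorem sandwich_tmul (T : Matrix m m k) (x y : A) :
    sandwich ρ T (x ⊗ₜ y) = ρ x * T * ρ y := rfl

theorem sandwich_one_tmul_mul (T : Matrix m m k) (a : A) (t : A ⊗[k] A) :
    sandwich ρ T ((1 ⊗ₜ a) * t) = sandwich ρ (T * ρ a) t := by
  induction t with
  | zero => simp
  | add x y hx hy => rw [mul_add, map_add, map_add, hx, hy]
  | tmul x y => simp [sandwich_tmul, mul_assoc]

theorem sandwich_mul_tmul_one (T : Matrix m m k) (a : A) (t : A ⊗[k] A) :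
    sandwich ρ T (t * (a ⊗ₜ 1)) = sandwich ρ (ρ a * T) t := by
  induction t with
  | zero => simp
  | add x y hx hy => rw [add_mul, map_add, map_add, hx, hy]
  | tmul x y => simp [sandwich_tmul, mul_assoc]

/-- The derivation `A → M_m(k)` obtained from a double derivation and a matrix, composed with
a functional. -/
def pairing (ℓ : (A →ₗ[k] Matrix m m k) →ₗ[k] k) (d : DoubleDer k A) : Matrix m m k →ₗ[k] k where
  toFun T := ℓ (sandwich ρ T ∘ₗ d.toLin)
  map_add' T T' := by rw [map_add, LinearMap.add_comp, map_add]
  map_smul' r T := by rw [map_smul, LinearMap.smul_comp, map_smul]; rfl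

/-- The bimodule map `Der(A, A ⊗ A) → M_m(k)` attached to a functional on `Hom(A, M_m(k))`. -/
def matrixOfDer (ℓ : (A →ₗ[k] Matrix m m k) →ₗ[k] k) (d : DoubleDer k A) : Matrix m m k :=
  traceDual (pairing ρ ℓ d)

variable (ℓ : (A →ₗ[k] Matrix m m k) →ₗ[k] k)

theorem trace_matrixOfDer_mul (d : DoubleDer k A) (T : Matrix m m k) :
    (matrixOfDer ρ ℓ d * T).trace = ℓ (sandwich ρ T ∘ₗ d.toLin) :=
  trace_traceDual_mul _ _

theorem matrixOfDer_add (d d' : DoubleDer k A) :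
    matrixOfDer ρ ℓ (d + d') = matrixOfDer ρ ℓ d + matrixOfDer ρ ℓ d' := by
  refine eq_of_trace_mul_eq fun T => ?_
  rw [add_mul, Matrix.trace_add, trace_matrixOfDer_mul, trace_matrixOfDer_mul,
    trace_matrixOfDer_mul, DoubleDer.toLin_add, LinearMap.comp_add, map_add]

/-- The inner left action replaces `T` by `T * ρ a` in the sandwich; cyclicity of the trace makes
this left multiplication by `ρ a`. -/
theorem matrixOfDer_smul (a : A) (d : DoubleDer k A) :
    matrixOfDer ρ ℓ (a • d) = ρ a * matrixOfDer ρ ℓ d := by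
  refine eq_of_trace_mul_eq fun T => ?_
  rw [mul_assoc (ρ a), Matrix.trace_mul_comm (ρ a), mul_assoc, trace_matrixOfDer_mul,
    trace_matrixOfDer_mul]
  congr 1
  ext1 x
  exact sandwich_one_tmul_mul ρ T a _

theorem matrixOfDer_op_smul (a : A) (d : DoubleDer k A) :
    matrixOfDer ρ ℓ (MulOpposite.op a • d) = matrixOfDer ρ ℓ d * ρ a := by
  refine eq_of_trace_mul_eq fun T => ?_
  rw [mul_assoc, trace_matrixOfDer_mul, trace_matrixOfDer_mul]
  congr 1
  ext1 x
  exact sandwich_mul_tmul_one ρ T a _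

/-- The map `T ↦ [ρ(·), T]`. -/
def commutatorMap : Matrix m m k →ₗ[k] A →ₗ[k] Matrix m m k where
  toFun T := LinearMap.mulRight k T ∘ₗ ρ.toLinearMap - LinearMap.mulLeft k T ∘ₗ ρ.toLinearMap
  map_add' T T' := by ext1 x; simp [mul_add, add_mul]; abel
  map_smul' r T := by ext1 x; simp [smul_sub]

theorem commutatorMap_apply (T : Matrix m m k) (x : A) :
    commutatorMap ρ T x = ρ x * T - T * ρ x := rfl

/-- Criterion for lifting: a representation `ρ` of `A` extends to `Π^λ(A)` if `λ` is orthogonal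
to all endomorphisms of `ρ` under the trace form. -/
theorem exists_algHom_of_trace_eq_zero (lam : A)
    (h : ∀ T : Matrix m m k, (∀ x, ρ x * T = T * ρ x) → (ρ lam * T).trace = 0) :
    ∃ Φ : DefPreproj k lam →ₐ[k] Matrix m m k, ∀ x, Φ (ofBase k lam x) = ρ x := by
  let g : Matrix m m k →ₗ[k] k := Matrix.traceLinearMap m k k ∘ₗ LinearMap.mulLeft k (ρ lam)
  -- The kernel of `T ↦ [ρ(·), T]` consists of the endomorphisms of `ρ`. As `g` vanishes on it, `g`
  -- factors through this map via a functional `ℓ`.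
  have hg : g ∈ LinearMap.range (commutatorMap ρ).dualMap := by
    rw [LinearMap.range_dualMap_eq_dualAnnihilator_ker, Submodule.mem_dualAnnihilator]
    intro T hT
    refine h T fun x => sub_eq_zero.mp ?_
    rw [← commutatorMap_apply, LinearMap.mem_ker.mp hT, LinearMap.zero_apply]
  obtain ⟨ℓ, hℓ⟩ := hg
  have hΔ : matrixOfDer ρ ℓ (DoubleDer.Delta k A) = ρ lam := by
    refine eq_of_trace_mul_eq fun T => ?_
    rw [trace_matrixOfDer_mul]
    -- Sandwiching `T` in `Δ x = x ⊗ 1 - 1 ⊗ x` yields `[ρ x, T]`, so the choice of `ℓ` sends `Δ` to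
    -- `ρ lam`.
    have hT : sandwich ρ T ∘ₗ (DoubleDer.Delta k A).toLin = commutatorMap ρ T := by
      ext1 x
      simp [DoubleDer.Delta, sandwich_tmul, commutatorMap_apply]
    rw [hT]
    exact LinearMap.congr_fun hℓ T
  let Ψ : BimodTensorAlgebra k A (DoubleDer k A) →ₐ[k] Matrix m m k :=
    RingQuot.liftAlgHom k ⟨FreeAlgebra.lift k (Sum.elim ρ (matrixOfDer ρ ℓ)), by
      intro x y hxy
      induction hxy with
      | base_add a b => simp
      | base_mul a b => simp
      | base_algebraMap r => simp
      | mod_add d d' => simp [matrixOfDer_add]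
      | left_smul a d => simp [matrixOfDer_smul]
      | right_smul d a => simp [matrixOfDer_op_smul]⟩
  have hbase (x : A) : Ψ (BimodTensorAlgebra.ofBase k A (DoubleDer k A) x) = ρ x := by
    refine (RingQuot.liftAlgHom_mkAlgHom_apply _ _ _ _).trans ?_
    simp
  have hder (d : DoubleDer k A) :
      Ψ (BimodTensorAlgebra.ofBimod k A (DoubleDer k A) d) = matrixOfDer ρ ℓ d := by
    refine (RingQuot.liftAlgHom_mkAlgHom_apply _ _ _ _).trans ?_
    simp
  refine ⟨RingQuot.liftAlgHom k ⟨Ψ, ?_⟩, fun x => ?_⟩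
  · rintro _ _ ⟨⟩
    rw [hbase, hder, hΔ]
  · exact (RingQuot.liftAlgHom_mkAlgHom_apply _ _ _ _).trans (hbase x)

end

end DefPreproj

/-! ### Points of the curve and fibres of the line bundle -/

section Points

variable {k O : Type*} [Field k] [CommRing O] [Algebra k O]

/-- As `O` is not a field, every point kills a nonzero function. For finitely many points the
product of such functions would be nonzero yet vanish everywhere. -/
theorem infinite_algHom_of_ringKrullDim_ne_zero [IsAlgClosed k] [IsDomain O]
    [Algebra.FiniteType k O] (hdim : ringKrullDim O ≠ 0) : Infinite (O →ₐ[k] k) := by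
  refine ⟨fun hfin => ?_⟩
  cases nonempty_fintype (O →ₐ[k] k)
  have hker (χ : O →ₐ[k] k) : ∃ a : O, a ≠ 0 ∧ χ a = 0 := by
    by_contra! h
    have hinj : Function.Injective χ :=
      (injective_iff_map_eq_zero χ).mpr fun a ha => by_contra fun h0 => h a h0 ha
    have hsurj : Function.Surjective χ := fun r => ⟨algebraMap k O r, χ.commutes r⟩
    exact hdim (ringKrullDim_eq_zero_of_isField
      ((AlgEquiv.ofBijective χ ⟨hinj, hsurj⟩).toMulEquiv.isField (Field.toIsField k)))
  choose a ha0 ha using hker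
  obtain ⟨χ, hχ⟩ := exists_algHom_apply_ne_zero (k := k) (a := ∏ χ, a χ)
    (Finset.prod_ne_zero_iff.mpr fun χ _ => ha0 χ)
  exact hχ (by rw [map_prod]; exact Finset.prod_eq_zero (Finset.mem_univ χ) (ha χ))

/-- Lagrange interpolation: multiply functions that are `1` at the `i`-th point and `0` at one other
point. -/
theorem exists_algHom_apply_eq_ite {ι : Type*} [Fintype ι] [DecidableEq ι] (χ : ι → O →ₐ[k] k)
    (hχ : Function.Injective χ) (i : ι) : ∃ a : O, ∀ j, χ j a = if j = i then 1 else 0 := by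
  have h (j : ι) : ∃ c : O, χ i c = 1 ∧ (j ≠ i → χ j c = 0) := by
    by_cases hj : j = i
    · exact ⟨1, map_one _, fun h => absurd hj h⟩
    · have hne : χ i ≠ χ j := fun h => hj (hχ h).symm
      obtain ⟨b, hb⟩ := DFunLike.ne_iff.mp hne
      refine ⟨(χ i b - χ j b)⁻¹ • (b - algebraMap k O (χ j b)), ?_, fun _ => ?_⟩
      · rw [map_smul, map_sub, AlgHom.commutes, Algebra.algebraMap_self_apply, smul_eq_mul,
          inv_mul_cancel₀ (sub_ne_zero.mpr hb)]
      · rw [map_smul, map_sub, AlgHom.commutes, Algebra.algebraMap_self_apply, sub_self,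
          smul_zero]
  choose c hc1 hc0 using h
  refine ⟨∏ j, c j, fun j => ?_⟩
  rw [map_prod]
  split_ifs with hj
  · rw [hj]; exact Finset.prod_eq_one fun l _ => hc1 l
  · exact Finset.prod_eq_zero (Finset.mem_univ j) (hc0 j hj)

/-- This is the fibre of `I` at `χ` with a trivialisation. It is nonzero because the contraction of
`I` with its dual reaches `1`. -/
theorem Module.Invertible.exists_semilinear_apply_eq_one {I : Type*} [AddCommGroup I] [Module k I]
    [Module O I] [IsScalarTower k O I] [Module.Invertible O I] (χ : O →ₐ[k] k) :
    ∃ (q : I →ₗ[k] k) (v : I), (∀ (a : O) (x : I), q (a • x) = χ a * q x) ∧ q v = 1 := by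
  have key : ∃ (g : I →ₗ[O] O) (v : I), χ (g v) ≠ 0 := by
    by_contra! h
    obtain ⟨t, ht⟩ := (Module.Invertible.bijective (R := O) (M := I)).surjective 1
    have h0 (t : Module.Dual O I ⊗[O] I) : χ (contractLeft O I t) = 0 := by
      induction t with
      | zero => simp
      | add x y hx hy => rw [map_add, map_add, hx, hy, add_zero]
      | tmul g v => rw [contractLeft_apply, h]
    have := h0 t
    rw [ht, map_one] at this
    exact one_ne_zero this
  obtain ⟨g, v, hv⟩ := key
  refine ⟨(χ (g v))⁻¹ • (χ.toLinearMap ∘ₗ g.restrictScalars k), v, fun a x => ?_, ?_⟩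
  · simp [mul_left_comm]
  · simp [inv_mul_cancel₀ hv]

/-- An invertible module over an affine domain of positive dimension has quotients of every finite
length. -/
theorem Module.Invertible.exists_surjective_pi [IsAlgClosed k] [IsDomain O]
    [Algebra.FiniteType k O] (hdim : ringKrullDim O ≠ 0) (I : Type*) [AddCommGroup I] [Module k I]
    [Module O I] [IsScalarTower k O I] [Module.Invertible O I] (n : ℕ) :
    ∃ (χ : Fin n → O →ₐ[k] k) (q : I →ₗ[k] Fin n → k), Function.Surjective q ∧
      ∀ a x i, q (a • x) i = χ i a * q x i := by
  have := infinite_algHom_of_ringKrullDim_ne_zero (k := k) hdim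
  let emb := Infinite.natEmbedding (O →ₐ[k] k)
  let χ : Fin n → O →ₐ[k] k := fun i => emb i
  have hχ : Function.Injective χ := emb.injective.comp Fin.val_injective
  choose q v hq hv using fun i => exists_semilinear_apply_eq_one (I := I) (χ i)
  choose a ha using exists_algHom_apply_eq_ite χ hχ
  refine ⟨χ, LinearMap.pi q, fun c => ⟨∑ i, c i • a i • v i, ?_⟩, fun b x i => hq i b x⟩
  ext j
  simp [hq, ha, hv]

end Points

/-! ### The representation attached to `n` points -/

namespace OnePointExt

open Matrix

variable {k O I : Type*} [Field k] [CommRing O] [Algebra k O]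
  [AddCommGroup I] [Module k I] [Module O I] [IsScalarTower k O I]

/-- The representation of `O[I]` by block matrices attached to points `χ` of `O` and fibre
functionals `q` of `I`. -/
def blockRep {ι : Type*} [Fintype ι] [DecidableEq ι] (χ : ι → O →ₐ[k] k) (q : I →ₗ[k] ι → k)
    (hq : ∀ a x i, q (a • x) i = χ i a * q x i) :
    OnePointExt k O I →ₐ[k] Matrix (ι ⊕ Unit) (ι ⊕ Unit) k where
  toFun x := fromBlocks (diagonal fun i => χ i x.corner) (replicateCol Unit (q x.vec)) 0
    (diagonal fun _ => x.scal)
  map_one' := by simp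
  map_zero' := by simp
  map_add' x y := by
    simp [fromBlocks_add, diagonal_add]
  map_mul' x y := by
    rw [fromBlocks_multiply]
    congr 1
    · simp
    · ext i j
      simp [hq, mul_comm]
    · simp
    · simp
  commutes' r := by
    have h : algebraMap k (OnePointExt k O I) r = ⟨algebraMap k O r, 0, r⟩ := rfl
    rw [h]
    ext (i | i) (j | j) <;> simp [algebraMap_matrix_apply, diagonal_apply]

variable {ι : Type*} [Fintype ι] [DecidableEq ι] {χ : ι → O →ₐ[k] k} {q : I →ₗ[k] ι → k}
  (hq : ∀ a x i, q (a • x) i = χ i a * q x i)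

theorem blockRep_apply (x : OnePointExt k O I) : blockRep χ q hq x =
    fromBlocks (diagonal fun i => χ i x.corner) (replicateCol Unit (q x.vec)) 0
      (diagonal fun _ => x.scal) := rfl

theorem trace_blockRep_e : (blockRep χ q hq (e k O I)).trace = Fintype.card ι := by
  simp [blockRep_apply, e, trace]

theorem trace_blockRep_eInf : (blockRep χ q hq (eInf k O I)).trace = 1 := by
  simp [blockRep_apply, eInf, trace]

/-- The endomorphisms of the representation are scalars if the fibre functionals are
jointly surjective, so that `(1, -n)` is orthogonal to them under the trace form. -/
theorem trace_blockRep_weight_mul (hsurj : Function.Surjective q)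
    (T : Matrix (ι ⊕ Unit) (ι ⊕ Unit) k)
    (hT : ∀ x, blockRep χ q hq x * T = T * blockRep χ q hq x) :
    (blockRep χ q hq (weight O I 1 (-(Fintype.card ι : k))) * T).trace = 0 := by
  have hvec (i j : ι) : T (Sum.inl i) (Sum.inl j) =
      if i = j then T (Sum.inr ()) (Sum.inr ()) else 0 := by
    -- For `v` with image the `j`-th basis vector, comparing the entries at `(i, ∞)` of the
    -- commutation relation computes `T i j`.
    obtain ⟨v, hv⟩ := hsurj (Pi.single j 1)
    have h := congrFun (congrFun (hT (ofVec k O I v)) (Sum.inl i)) (Sum.inr ())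
    simp [blockRep_apply, ofVec, mul_apply, hv, Pi.single_apply] at h
    rw [← h]
  simp [blockRep_apply, weight, e, eInf, trace, mul_apply, hvec, fromBlocks]

end OnePointExt

/-- A representation of `Π^λ(A[I])` by matrices gives a module whose dimension vector is read off
from the traces of `e` and `e_∞`. -/
theorem exists_module_hasDimVector_of_algHom.{u} {k : Type u} {m : Type} {A I : Type*} [Field k]
    [CharZero k] [Ring A] [Algebra k A] [AddCommGroup I] [Module k I] [Module A I]
    [IsScalarTower k A I] [Fintype m] [DecidableEq m] {lam : OnePointExt k A I}
    (Φ : DefPreproj k lam →ₐ[k] Matrix m m k) {n l : ℕ}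
    (hn : (Φ (DefPreproj.ofBase k lam (OnePointExt.e k A I))).trace = n)
    (hl : (Φ (DefPreproj.ofBase k lam (OnePointExt.eInf k A I))).trace = l) :
    ∃ (V : Type u) (_ : AddCommGroup V) (_ : Module k V) (_ : Module (DefPreproj k lam) V)
      (_ : IsScalarTower k (DefPreproj k lam) V), HasDimVector (lam := lam) V n l := by
  let Ψ : DefPreproj k lam →ₐ[k] Module.End k (m → k) :=
    (Matrix.toLinAlgEquiv' : Matrix m m k ≃ₐ[k] _).toAlgHom.comp Φ
  let : Module (DefPreproj k lam) (m → k) := Module.compHom (m → k) Ψ.toRingHom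
  have htower : IsScalarTower k (DefPreproj k lam) (m → k) :=
    ⟨fun r x v => LinearMap.congr_fun (map_smul Ψ r x) v⟩
  have key (x : OnePointExt k A I) (hx : x * x = x) {d : ℕ}
      (hd : (Φ (DefPreproj.ofBase k lam x)).trace = d) :
      Module.finrank k (LinearMap.range (Algebra.lsmul k k (m → k)
        (DefPreproj.ofBase k lam x))) = d := by
    have hid : IsIdempotentElem (Algebra.lsmul k k (m → k) (DefPreproj.ofBase k lam x)) := by
      rw [IsIdempotentElem, ← map_mul, ← map_mul, hx]
    have htr : LinearMap.trace k (m → k) (Algebra.lsmul k k (m → k) (DefPreproj.ofBase k lam x)) =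
        (Φ (DefPreproj.ofBase k lam x)).trace :=
      Matrix.trace_toLin'_eq _
    rw [LinearMap.trace_eq_finrank_range_of_isIdempotentElem hid, hd] at htr
    exact_mod_cast htr
  exact ⟨m → k, inferInstance, inferInstance, inferInstance, htower, inferInstance,
    key _ OnePointExt.e_mul_e hn, key _ OnePointExt.eInf_mul_eInf hl⟩

/-- Existence of modules of dimension vector `(n, 1)` over `Π^λ(O[I])`, `λ = (1, -n)`. -/
theorem exists_module_hasDimVector.{u} {k : Type u} {O I : Type*} [Field k] [CharZero k]
    [IsAlgClosed k] [CommRing O] [IsDomain O] [Algebra k O] [Algebra.FiniteType k O]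
    (hdim : ringKrullDim O ≠ 0) [AddCommGroup I] [Module k I] [Module O I] [IsScalarTower k O I]
    [Module.Invertible O I] {n : ℕ} {lam : OnePointExt k O I}
    (hlam : lam = OnePointExt.weight O I (1 : k) (-(n : k))) :
    ∃ (V : Type u) (_ : AddCommGroup V) (_ : Module k V) (_ : Module (DefPreproj k lam) V)
      (_ : IsScalarTower k (DefPreproj k lam) V), HasDimVector (lam := lam) V n 1 := by
  obtain ⟨χ, q, hsurj, hq⟩ := Module.Invertible.exists_surjective_pi (k := k) hdim I n
  obtain ⟨Φ, hΦ⟩ := DefPreproj.exists_algHom_of_trace_eq_zero (OnePointExt.blockRep χ q hq) lam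
    (fun T hT => by
      have h := OnePointExt.trace_blockRep_weight_mul hq hsurj T hT
      rwa [Fintype.card_fin, ← hlam] at h)
  refine exists_module_hasDimVector_of_algHom Φ ?_ ?_
  · rw [hΦ, OnePointExt.trace_blockRep_e, Fintype.card_fin]
  · rw [hΦ, OnePointExt.trace_blockRep_eInf, Nat.cast_one]

theorem mainTheorem7 {O : Type*} [CommRing O] [IsDomain O] [Algebra ℂ O]
    [Algebra.Smooth ℂ O] (hdim : ringKrullDim O = 1)
    {I : Type*} [AddCommGroup I] [Module ℂ I] [Module O I] [IsScalarTower ℂ O I]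
    [Module.Invertible O I] (n : ℕ) :
    (∃ (V : Type) (_ : AddCommGroup V) (_ : Module ℂ V)
        (_ : Module (DefPreproj ℂ (OnePointExt.weight O I (1 : ℂ) (-(n : ℂ)))) V)
        (_ : IsScalarTower ℂ (DefPreproj ℂ (OnePointExt.weight O I (1 : ℂ) (-(n : ℂ)))) V),
        HasDimVector (lam := OnePointExt.weight O I (1 : ℂ) (-(n : ℂ))) V n 1) ∧
    (∀ (V : Type*) [AddCommGroup V] [Module ℂ V]
        [Module (DefPreproj ℂ (OnePointExt.weight O I (1 : ℂ) (-(n : ℂ)))) V]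
        [IsScalarTower ℂ (DefPreproj ℂ (OnePointExt.weight O I (1 : ℂ) (-(n : ℂ)))) V],
        HasDimVector (lam := OnePointExt.weight O I (1 : ℂ) (-(n : ℂ))) V n 1 →
          IsSimpleModule (DefPreproj ℂ (OnePointExt.weight O I (1 : ℂ) (-(n : ℂ)))) V) := by
  refine ⟨exists_module_hasDimVector (by rw [hdim]; exact one_ne_zero) rfl, ?_⟩
  intro V _ _ _ _ hV
  -- A splitting of `O^r → I` supplies the dual basis for the Grassmann connection.
  obtain ⟨r, π, g, -, -, hg⟩ := Module.Finite.exists_comp_eq_id_of_projective O I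
  have hyf (v : I) : ∑ i, (LinearMap.proj i ∘ₗ g) v • π (Pi.single i 1) = v := by
    calc _ = π (g v) := by
          conv_rhs => rw [pi_eq_sum_univ' (g v), map_sum]
          simp [map_smul]
      _ = v := LinearMap.congr_fun hg v
  exact HasDimVector.isSimpleModule (OnePointExt.Delta_mem_commutators hyf
    (KaehlerDifferential.ideal_subtype_mem_smul_top ℂ O hdim.le)) rfl V hV
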